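/- Let $\omega=\frac{-1+\sqrt{-3}}{2}$, let $E_\omega=\mathbf{C}/(\mathbf{Z}+\mathbf{Z}\omega)$, and let $Y$ be the canonical resolution of the quotient threefold $E_\omega\times E_\omega\times E_\omega/\langle \mathrm{diag}(-\omega,-\omega,-\omega)\rangle$, that is, its blow-up at its singular points, which are of type $\frac12(1,1,1)$, $\frac13(1,1,1)$ and $\frac16(1,1,1)$. Then the smooth projective threefold $Y$ is birationally equivalent to the affine hypersurface $Q$ in the affine space $\mathbf{A}^4$ over $\mathbf{C}$ with coordinates $(t,s,z,w)$ defined by $$(w^3-1)(t^2-1)=(z^3-1)(s^2-1).$$ Here birational equivalence means that there is an isomorphism from a dense Zariski open subset of $Y$ to a dense Zariski open subset of $Q$ whose coordinate functions are rational (equivalently, meromorphic) functions on $Y$. -/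

import Mathlib

open scoped Topology LinearAlgebra.Projectivization

noncomputable section

namespace TorusQuotient

/-! ### The elliptic curve `E_ω` and the group `⟨-ω⟩` -/

/-- `ω = (-1 + √-3) / 2`. -/
def omega : ℂ := (-1 + (Real.sqrt 3 : ℂ) * Complex.I) / 2

theorem omega_sq : omega * omega = -1 - omega := by
  have h3 : (Real.sqrt 3 : ℂ) * (Real.sqrt 3 : ℂ) = 3 := by
    rw [← Complex.ofReal_mul, Real.mul_self_sqrt (by norm_num)]; norm_num
  have hI := Complex.I_mul_I
  unfold omega
  linear_combination (1 / 4 : ℂ) * Complex.I * Complex.I * h3 + (3 / 4 : ℂ) * hI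

theorem neg_omega_mul : (-omega) * (1 + omega) = 1 := by
  linear_combination -omega_sq

/-- `-ω` as a unit of `ℂ`; it is a primitive sixth root of unity. -/
def negOmega : ℂˣ where
  val := -omega
  inv := 1 + omega
  val_inv := neg_omega_mul
  inv_val := by rw [mul_comm]; exact neg_omega_mul

/-- The cyclic group of order six generated by `-ω`. It acts on `ℂ³`, and on `E_ω³`, by the scalar
matrices `diag(ζ, ζ, ζ)`. -/
def G : Subgroup ℂˣ := Subgroup.zpowers negOmega

/-- The lattice `ℤ + ℤω`. -/
def lattice : AddSubgroup ℂ := AddSubgroup.closure {1, omega}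

/-- The elliptic curve `E_ω = ℂ / (ℤ + ℤω)`. -/
abbrev Eomega : Type := ℂ ⧸ lattice

/-- The three-dimensional complex vector space `ℂ³`, the universal cover of `E_ω³`. -/
abbrev C3 : Type := Fin 3 → ℂ

/-- The covering map `ℂ³ → E_ω³`. -/
def toTorus (z : C3) : Fin 3 → Eomega := fun i => (z i : Eomega)

/-! ### The blow-up at the points with non-trivial stabiliser -/

/-- The points of `ℂ³` lying over those points of `E_ω³` that are fixed by `diag(ζ, ζ, ζ)` for some
`ζ ≠ 1` in `⟨-ω⟩`. It is a discrete set, and it is the inverse image in `ℂ³` of the singular locus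
of `E_ω³ / ⟨diag(-ω, -ω, -ω)⟩`. -/
def fixedPoints : Set C3 :=
  {p | ∃ ζ ∈ G, ζ ≠ 1 ∧ toTorus ((ζ : ℂ) • p) = toTorus p}

/-- The quotient topology on the complex projective plane. -/
instance : TopologicalSpace (ℙ ℂ C3) :=
  inferInstanceAs (TopologicalSpace (Quotient (projectivizationSetoid ℂ C3)))

/-- The blow-up of `ℂ³` at the discrete set `fixedPoints`, as an incidence variety: a point is a
point `z` of `ℂ³` together with, for every blown up point `p`, a line `ℓ p` through the origin that
contains `z - p`. The line `ℓ p` is determined by `z` unless `z = p`. -/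
@[ext]
structure BlowUp where
  /-- The image in `ℂ³`. -/
  z : C3
  /-- The line attached to each blown up point. -/
  line : fixedPoints → ℙ ℂ C3
  /-- The incidence relation. -/
  incident : ∀ p : fixedPoints, z - (p : C3) ∈ (line p).submodule

/-- The topology of the blow-up as a subspace of `ℂ³ × (ℙ²)^fixedPoints`. -/
instance : TopologicalSpace BlowUp :=
  TopologicalSpace.induced (fun x => (x.z, x.line)) inferInstance

/-- The affine coordinates `(v₀ / vᵢ, v₁ / vᵢ, v₂ / vᵢ)` of a point `[v₀ : v₁ : v₂]` of `ℙ²`. -/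
def affineCoord (i : Fin 3) (ℓ : ℙ ℂ C3) : C3 := fun j => ℓ.rep j / ℓ.rep i

/-- Holomorphy at a point `x` of the blow-up of a function defined near `x`. Away from the
exceptional divisors the function is locally an analytic function of `z`. At a point over a blown
up point `p` it is locally the restriction of an analytic function on `ℂ³ × ℙ²` (the blow-up being
there the submanifold `{(z, ℓ) | z - p ∈ ℓ}`), the second factor in affine coordinates. -/
def BlowUp.HolAt (f : BlowUp → ℂ) (x : BlowUp) : Prop :=
  (x.z ∉ fixedPoints ∧ ∃ F : C3 → ℂ, AnalyticAt ℂ F x.z ∧ ∀ᶠ y in 𝓝 x, f y = F y.z) ∨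
  (∃ p : fixedPoints, x.z = p ∧ ∃ i : Fin 3, (x.line p).rep i ≠ 0 ∧
    ∃ F : C3 × C3 → ℂ, AnalyticAt ℂ F (x.z, affineCoord i (x.line p)) ∧
      ∀ᶠ y in 𝓝 x, f y = F (y.z, affineCoord i (y.line p)))

/-! ### The threefold `Y` -/

theorem unit_mul_mem_lattice {ζ : ℂˣ} (hζ : ζ ∈ G) {a : ℂ} (ha : a ∈ lattice) :
    (ζ : ℂ) * a ∈ lattice := by
  have h1 : (1 : ℂ) ∈ lattice := AddSubgroup.subset_closure (by simp)
  have hω : omega ∈ lattice := AddSubgroup.subset_closure (by simp)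
  have key : ∀ a ∈ lattice, omega * a ∈ lattice := by
    intro a ha
    induction ha using AddSubgroup.closure_induction with
    | mem x hx =>
      rcases hx with rfl | hx
      · simpa using hω
      · rw [Set.mem_singleton_iff] at hx
        rw [hx, omega_sq]
        exact lattice.sub_mem (lattice.neg_mem h1) hω
    | zero => simp
    | add x y _ _ hx hy => rw [mul_add]; exact lattice.add_mem hx hy
    | neg x _ hx => rw [mul_neg]; exact lattice.neg_mem hx
  obtain ⟨n, rfl⟩ := Subgroup.mem_zpowers_iff.mp hζ
  induction n using Int.induction_on with
  | zero => simpa using ha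
  | succ n ih =>
    have h2 : ((negOmega ^ ((n : ℤ) + 1) : ℂˣ) : ℂ) * a
        = -(omega * (((negOmega ^ (n : ℤ) : ℂˣ) : ℂ) * a)) := by
      have : (negOmega : ℂ) = -omega := rfl
      rw [zpow_add_one, Units.val_mul, this]; ring
    rw [h2]; exact lattice.neg_mem (key _ (ih (Subgroup.zpow_mem_zpowers _ _)))
  | pred n ih =>
    have h2 : ((negOmega ^ (-(n : ℤ) - 1) : ℂˣ) : ℂ) * a
        = ((negOmega ^ (-(n : ℤ)) : ℂˣ) : ℂ) * a
          + omega * (((negOmega ^ (-(n : ℤ)) : ℂˣ) : ℂ) * a) := by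
      have : ((negOmega⁻¹ : ℂˣ) : ℂ) = 1 + omega := rfl
      rw [zpow_sub_one, Units.val_mul, this]; ring
    have h3 := ih (Subgroup.zpow_mem_zpowers _ _)
    rw [h2]; exact lattice.add_mem h3 (key _ h3)

theorem toTorus_eq_iff {z w : C3} : toTorus z = toTorus w ↔ ∀ i, w i - z i ∈ lattice := by
  simp only [toTorus, funext_iff, QuotientAddGroup.eq, sub_eq_neg_add]

theorem toTorus_smul {ζ : ℂˣ} (hζ : ζ ∈ G) {z w : C3} (h : toTorus z = toTorus w) :
    toTorus ((ζ : ℂ) • z) = toTorus ((ζ : ℂ) • w) := by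
  rw [toTorus_eq_iff] at h ⊢
  intro i
  have := unit_mul_mem_lattice hζ (h i)
  simpa [mul_sub] using this

theorem toTorus_add {a b c d : C3} (h : toTorus a = toTorus b) (h' : toTorus c = toTorus d) :
    toTorus (a + c) = toTorus (b + d) := by
  funext i
  have h1 := congrFun h i
  have h2 := congrFun h' i
  simp only [toTorus] at h1 h2 ⊢
  simp only [Pi.add_apply, QuotientAddGroup.mk_add, h1, h2]

/-- The set of blown up points is stable under the affine maps `p ↦ w + ζ (p - z)` that induce
`diag(ζ, ζ, ζ)` on `E_ω³`. -/
theorem fixedPoints_affine {ζ : ℂˣ} (hζ : ζ ∈ G) {z w p : C3}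
    (h : toTorus w = toTorus ((ζ : ℂ) • z)) (hp : p ∈ fixedPoints) :
    w + (ζ : ℂ) • (p - z) ∈ fixedPoints := by
  have e : toTorus (w + (ζ : ℂ) • (p - z)) = toTorus ((ζ : ℂ) • p) := by
    rw [toTorus_add h (rfl : toTorus ((ζ : ℂ) • (p - z)) = _), ← smul_add, add_sub_cancel]
  obtain ⟨ξ, hξ, hne, hfix⟩ := hp
  refine ⟨ξ, hξ, hne, ?_⟩
  rw [toTorus_smul hξ e, e, smul_comm]
  exact toTorus_smul hζ hfix

/-- Two points of the blow-up of `ℂ³` have the same image in `Y` if one is carried to the other by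
an affine automorphism `γ : p ↦ w + ζ (p - z)` of `ℂ³` (here `γ z = w`) with `ζ ∈ ⟨-ω⟩` that induces
`diag(ζ, ζ, ζ)` on `E_ω³`. The linear part of `γ` is scalar, so that it maps every line to itself;
hence `γ` carries the line attached to `p` to the same line, attached to `γ p`. -/
def quotientSetoid : Setoid BlowUp where
  r x y := ∃ ζ ∈ G, toTorus y.z = toTorus ((ζ : ℂ) • x.z) ∧
    ∀ p p' : fixedPoints, (p' : C3) = y.z + (ζ : ℂ) • ((p : C3) - x.z) → y.line p' = x.line p
  iseqv := by
    refine ⟨?_, ?_, ?_⟩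
    · intro x
      refine ⟨1, G.one_mem, by simp, ?_⟩
      intro p p' h
      have : p' = p := Subtype.ext (by simpa using h)
      rw [this]
    · rintro x y ⟨ζ, hζ, hT, hl⟩
      refine ⟨ζ⁻¹, G.inv_mem hζ, ?_, ?_⟩
      · have := toTorus_smul (G.inv_mem hζ) hT
        rw [this, smul_smul]
        simp
      · intro p p' h
        refine (hl p' p ?_).symm
        rw [h, add_sub_cancel_left, smul_smul]
        simp
    · rintro x y w ⟨ζ, hζ, hT, hl⟩ ⟨ξ, hξ, hT', hl'⟩
      refine ⟨ξ * ζ, G.mul_mem hξ hζ, ?_, ?_⟩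
      · rw [hT', toTorus_smul hξ hT, smul_smul, Units.val_mul]
      · intro p p' h
        rw [← hl p ⟨_, fixedPoints_affine hζ hT p.2⟩ rfl]
        refine hl' _ _ ?_
        rw [h, add_sub_cancel_left, smul_smul, Units.val_mul]

/-- The threefold `Y`, the canonical resolution of `E_ω³ / ⟨diag(-ω, -ω, -ω)⟩`. Near a point with
stabiliser of order `m > 1` the quotient is `ℂ³ / μ_m` with `μ_m` acting by scalars (a singularity
of type `1/m(1,1,1)`), and its blow-up at the singular point is the quotient by `μ_m` of the blow-up
of `ℂ³` at the origin. -/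
def Y : Type := Quotient quotientSetoid

/-- The quotient map from the blow-up of `ℂ³` to `Y`. -/
def Y.mk (x : BlowUp) : Y := Quotient.mk quotientSetoid x

instance : TopologicalSpace Y := inferInstanceAs (TopologicalSpace (Quotient quotientSetoid))

/-- Holomorphy at `y` of a function defined near `y`: the structure sheaf of a quotient is the sheaf
of invariant holomorphic functions upstairs. -/
def Y.HolAt (f : Y → ℂ) (y : Y) : Prop :=
  ∀ x : BlowUp, Y.mk x = y → BlowUp.HolAt (fun x' => f (Y.mk x')) x

/-- `A` is an analytic subset of `Y`: near every point of `Y` it is the set of common zeros of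
finitely many holomorphic functions. (As `Y` is projective, these are the Zariski closed sets.) -/
def Y.IsAnalyticSubset (A : Set Y) : Prop :=
  ∀ y : Y, ∃ V : Set Y, IsOpen V ∧ y ∈ V ∧ ∃ (n : ℕ) (h : Fin n → Y → ℂ),
    (∀ k, ∀ y' ∈ V, Y.HolAt (h k) y') ∧ ∀ y' ∈ V, (y' ∈ A ↔ ∀ k, h k y' = 0)

/-- A function `f`, given on a dense open subset `U` of `Y`, is a meromorphic function on `Y`: near
every point of `Y`, also outside `U`, it is a quotient of holomorphic functions whose denominator
vanishes on no non-empty open set. (As `Y` is projective, these are the rational functions.) -/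
def Y.IsMeromorphic (U : Set Y) (f : U → ℂ) : Prop :=
  ∀ y : Y, ∃ V : Set Y, IsOpen V ∧ y ∈ V ∧ ∃ g h : Y → ℂ,
    (∀ y' ∈ V, Y.HolAt g y' ∧ Y.HolAt h y') ∧
    V ⊆ closure {y' ∈ V | h y' ≠ 0} ∧
    ∀ u : U, (u : Y) ∈ V → h u * f u = g u

/-! ### Birational equivalence with an affine variety -/

/-- `U` is a Zariski open and Zariski dense subset of the closed subvariety `Q` of `𝔸ⁿ`. -/
def IsZariskiDenseOpen {n : ℕ} (Q U : Set (Fin n → ℂ)) : Prop :=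
  (∃ J : Set (MvPolynomial (Fin n) ℂ), U = {q ∈ Q | ∃ P ∈ J, MvPolynomial.eval q P ≠ 0}) ∧
  ∀ P : MvPolynomial (Fin n) ℂ,
    (∀ q ∈ U, MvPolynomial.eval q P = 0) → ∀ q ∈ Q, MvPolynomial.eval q P = 0

/-- `Y` is birationally equivalent to the affine variety `Q ⊆ 𝔸ⁿ`: there are dense Zariski open
subsets `U ⊆ Y` and `U' ⊆ Q` and an isomorphism `e : U ≅ U'` (a homeomorphism under which the
holomorphic functions of `Y` correspond to the local restrictions to `Q` of analytic functions on
`ℂⁿ`) which is rational, i.e. whose coordinates are meromorphic functions on all of `Y`.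
The inverse is then rational too: `Y` is projective, so that its meromorphic functions are its
rational functions, and a dominant rational map that is injective on a dense open set has
degree one. -/
def Y.BirationalTo {n : ℕ} (Q : Set (Fin n → ℂ)) : Prop :=
  ∃ (U : Set Y) (U' : Set (Fin n → ℂ)) (e : U ≃ₜ U'),
    Y.IsAnalyticSubset Uᶜ ∧ Dense U ∧ IsZariskiDenseOpen Q U' ∧
    (∀ (u : U) (h : Y → ℂ), Y.HolAt h u ↔
      ∃ F : (Fin n → ℂ) → ℂ, AnalyticAt ℂ F (e u : Fin n → ℂ) ∧
        ∀ᶠ u' : U in 𝓝 u, h (u' : Y) = F (e u' : Fin n → ℂ)) ∧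
    ∀ k : Fin n, Y.IsMeromorphic U (fun u => (e u : Fin n → ℂ) k)

/-- The hypersurface `(w³ - 1)(t² - 1) = (z³ - 1)(s² - 1)` in `𝔸⁴` with coordinates
`(t, s, z, w)`. -/
def hypersurfaceQ : Set (Fin 4 → ℂ) :=
  {q | (q 3 ^ 3 - 1) * (q 0 ^ 2 - 1) = (q 2 ^ 3 - 1) * (q 1 ^ 2 - 1)}

end TorusQuotient

end

/-!
The functions `x` and `y`, multiples of `℘` and `℘'`, identify `E_ω` with the curve `y² = x³ + 1`,
and `-ω` acts by `x ↦ ω x`, `y ↦ -y`. Hence the ratios `t = y₀ / y₂`, `s = y₁ / y₂`,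
`z = x₀ / x₂` and `w = x₁ / x₂` are invariant under the group. Eliminating `x₂³` and `y₂²` from
the three equations `yᵢ² = xᵢ³ + 1` yields the equation of the hypersurface. Conversely, the four
ratios determine `x₂³` and `y₂²`, hence `(x₂, y₂)` up to the action of the sixth roots of unity;
therefore they separate the orbits.
-/

noncomputable section

namespace TorusQuotient

open Filter Bornology

/-! ### Weierstrass functions -/

section Weierstrass

theorem eventually_eq_zero_of_deriv_deriv_eq_mul {d k : ℂ → ℂ} {a : ℂ} (hd : AnalyticAt ℂ d a)
    (hk : AnalyticAt ℂ k a) (value : d a = 0) (slope : deriv d a = 0)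
    (ode : ∀ᶠ z in 𝓝 a, deriv (deriv d) z = k z * d z) : ∀ᶠ z in 𝓝 a, d z = 0 := by
  -- A finite order `n ≥ 2` of vanishing of `d` would give `n - 2 = ord k + n`.
  rw [← analyticOrderAt_eq_top]
  have order_deriv := hd.analyticOrderAt_deriv_add_one
  have order_deriv_deriv := hd.deriv.analyticOrderAt_deriv_add_one
  rw [analyticOrderAt_congr ode, show (fun z => k z * d z) = k * d from rfl,
    analyticOrderAt_mul hk hd] at order_deriv_deriv
  simp only [value, slope, sub_zero] at order_deriv order_deriv_deriv
  by_contra hne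
  lift analyticOrderAt d a to ℕ using hne with n
  rw [← order_deriv_deriv] at order_deriv
  generalize analyticOrderAt k a = m at order_deriv
  induction m with
  | top => simp at order_deriv
  | coe m => norm_cast at order_deriv; omega

theorem analyticAt_inv_of_tendsto_cobounded {f : ℂ → ℂ} {l : ℂ}
    (hd : ∀ᶠ z in 𝓝[≠] l, DifferentiableAt ℂ f z)
    (hf : Tendsto f (𝓝[≠] l) (cobounded ℂ)) (hl : f l = 0) : AnalyticAt ℂ f⁻¹ l := by
  refine Complex.analyticAt_of_differentiable_on_punctured_nhds_of_continuousAt ?_ ?_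
  · filter_upwards [hd, hf.eventually_ne_cobounded 0] with z hz hz0 using hz.inv hz0
  · rw [continuousAt_iff_punctured_nhds, Pi.inv_apply, hl, inv_zero]
    exact tendsto_inv₀_cobounded.comp hf

theorem isPreconnected_compl_of_countable {s : Set ℂ} (hs : s.Countable) : IsPreconnected sᶜ :=
  (hs.isConnected_compl_of_one_lt_rank (by simp)).isPreconnected

variable (L : PeriodPair)

theorem isOpen_compl_periodLattice : IsOpen ((L.lattice : Set ℂ)ᶜ) :=
  L.isClosed_lattice.isOpen_compl

theorem countable_periodLattice : (L.lattice : Set ℂ).Countable :=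
  Set.countable_coe_iff.mp L.latticeEquivProd.injective.countable

theorem eventually_notMem_periodLattice (l : ℂ) : ∀ᶠ z in 𝓝[≠] l, z ∉ L.lattice := by
  filter_upwards [mem_nhdsWithin_of_mem_nhds (L.compl_lattice_sdiff_singleton_mem_nhds l),
    self_mem_nhdsWithin] with z hz hne hmem
  exact hz ⟨hmem, hne⟩

variable {L}

theorem tendsto_weierstrassP_cobounded {l : ℂ} (hl : l ∈ L.lattice) :
    Tendsto L.weierstrassP (𝓝[≠] l) (cobounded ℂ) := by
  have order : meromorphicOrderAt L.weierstrassP l = ((-2 : ℤ) : WithTop ℤ) :=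
    L.order_weierstrassP l hl
  refine tendsto_cobounded_of_meromorphicOrderAt_neg ?_
  rw [order]
  exact WithTop.coe_lt_coe.mpr (by norm_num)

theorem tendsto_derivWeierstrassP_cobounded {l : ℂ} (hl : l ∈ L.lattice) :
    Tendsto L.derivWeierstrassP (𝓝[≠] l) (cobounded ℂ) := by
  have order : meromorphicOrderAt L.weierstrassP l = ((-3 + 1 : ℤ) : WithTop ℤ) :=
    L.order_weierstrassP l hl
  refine tendsto_cobounded_of_meromorphicOrderAt_neg ?_
  rw [← L.deriv_weierstrassP, meromorphicOrderAt_deriv (by norm_num) order]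
  exact WithTop.coe_lt_coe.mpr (by norm_num)

theorem hasDerivAt_weierstrassP {z : ℂ} (hz : z ∉ L.lattice) :
    HasDerivAt L.weierstrassP (L.derivWeierstrassP z) z := by
  rw [← L.deriv_weierstrassP]
  exact (L.analyticOnNhd_weierstrassP z hz).differentiableAt.hasDerivAt

theorem hasDerivAt_derivWeierstrassP {z : ℂ} (hz : z ∉ L.lattice) :
    HasDerivAt L.derivWeierstrassP (6 * L.weierstrassP z ^ 2 - L.g₂ / 2) z := by
  have analytic := L.analyticOnNhd_derivWeierstrassP
  have defect_analytic : AnalyticOnNhd ℂ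
      (fun z => 2 * deriv L.derivWeierstrassP z - (12 * L.weierstrassP z ^ 2 - L.g₂))
      (L.lattice : Set ℂ)ᶜ := by
    intro z hz
    have := (analytic z hz).deriv
    have := L.analyticOnNhd_weierstrassP z hz
    fun_prop
  -- The derivative of `℘'² = 4 ℘³ - g₂ ℘ - g₃` is `℘'` times the relation sought.
  have mul_defect : ∀ z ∈ (L.lattice : Set ℂ)ᶜ, L.derivWeierstrassP z *
      (2 * deriv L.derivWeierstrassP z - (12 * L.weierstrassP z ^ 2 - L.g₂)) = 0 := by
    intro z hz
    have relation : (fun z => L.derivWeierstrassP z ^ 2) =ᶠ[𝓝 z]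
        fun z => 4 * L.weierstrassP z ^ 3 - L.g₂ * L.weierstrassP z - L.g₃ := by
      filter_upwards [(isOpen_compl_periodLattice L).mem_nhds hz] with w hw
        using L.derivWeierstrassP_sq w hw
    have deriv_left := (analytic z hz).differentiableAt.hasDerivAt.pow 2
    have hp := hasDerivAt_weierstrassP hz
    have deriv_right := (((hp.pow 3).const_mul 4).sub (hp.const_mul L.g₂)).sub_const L.g₃
    have := deriv_left.unique (deriv_right.congr_of_eventuallyEq relation)
    simp only [Nat.cast_ofNat] at this
    linear_combination this
  rcases analytic.eq_zero_or_eq_zero_of_mul_eq_zero defect_analytic mul_defect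
    (isPreconnected_compl_of_countable (countable_periodLattice L)) with deriv_zero | defect_zero
  · obtain ⟨w, hw, hwL⟩ := (((tendsto_derivWeierstrassP_cobounded L.lattice.zero_mem
      ).eventually_ne_cobounded 0).and (eventually_notMem_periodLattice L 0)).exists
    exact absurd (deriv_zero w hwL) hw
  · have deriv_eq : deriv L.derivWeierstrassP z = 6 * L.weierstrassP z ^ 2 - L.g₂ / 2 := by
      linear_combination (1 / 2 : ℂ) * defect_zero z hz
    exact deriv_eq ▸ (analytic z hz).differentiableAt.hasDerivAt

theorem analyticAt_inv_indicator_weierstrassP_sub {c : ℂ}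
    (hc : ∀ z ∉ L.lattice, L.weierstrassP z ≠ c) (z : ℂ) :
    AnalyticAt ℂ ((L.lattice : Set ℂ)ᶜ.indicator fun w => L.weierstrassP w - c)⁻¹ z := by
  set F := (L.lattice : Set ℂ)ᶜ.indicator fun w => L.weierstrassP w - c
  have off_lattice : ∀ w ∉ L.lattice, F =ᶠ[𝓝 w] fun w => L.weierstrassP w - c := by
    intro w hw
    filter_upwards [(isOpen_compl_periodLattice L).mem_nhds hw] with v hv
      using Set.indicator_of_mem hv _
  have analytic : ∀ w ∉ L.lattice, AnalyticAt ℂ F w := fun w hw =>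
    ((L.analyticOnNhd_weierstrassP w hw).sub analyticAt_const).congr (off_lattice w hw).symm
  by_cases hz : z ∈ L.lattice
  · refine analyticAt_inv_of_tendsto_cobounded ?_ ?_ (Set.indicator_of_notMem (not_not.mpr hz) _)
    · filter_upwards [eventually_notMem_periodLattice L z] with w hw
        using (analytic w hw).differentiableAt
    · refine ((tendsto_sub_const_cobounded c).comp (tendsto_weierstrassP_cobounded hz)).congr' ?_
      filter_upwards [eventually_notMem_periodLattice L z] with w hw
        using (off_lattice w hw).self_of_nhds.symm
  · refine (analytic z hz).inv ?_
    rw [(off_lattice z hz).self_of_nhds]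
    exact sub_ne_zero.mpr (hc z hz)

theorem exists_weierstrassP_eq (c : ℂ) : ∃ z ∉ L.lattice, L.weierstrassP z = c := by
  -- If `℘` omits `c` then the extension of `(℘ - c)⁻¹` by `0` is entire and doubly periodic.
  by_contra! omitted
  set F := ((L.lattice : Set ℂ)ᶜ.indicator fun w => L.weierstrassP w - c)⁻¹ with hF
  have entire : Differentiable ℂ F :=
    fun z => (analyticAt_inv_indicator_weierstrassP_sub omitted z).differentiableAt
  have periodic : ∀ z, ∀ l ∈ L.lattice, F (z + l) = F z := by
    intro z l hl
    have hP : L.weierstrassP (z + l) = L.weierstrassP z := L.weierstrassP_add_coe z ⟨l, hl⟩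
    by_cases hz : z ∈ L.lattice
    · simp [hF, hz, L.lattice.add_mem hz hl]
    · simp [hF, hz, (L.lattice.add_mem_iff_left hl).not.mpr hz, hP]
  have constant := entire.apply_eq_apply_of_bounded
    (IsZLattice.isCompact_range_of_periodic L.lattice _ entire.continuous periodic).isBounded
    (L.ω₁ / 2) 0
  have notMem := L.ω₁_div_two_notMem_lattice
  simp only [hF, Pi.inv_apply, inv_inj,
    Set.indicator_of_mem (show L.ω₁ / 2 ∈ (L.lattice : Set ℂ)ᶜ from notMem),
    Set.indicator_of_notMem (show (0 : ℂ) ∉ (L.lattice : Set ℂ)ᶜ from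
      not_not.mpr L.lattice.zero_mem)] at constant
  exact omitted _ notMem (sub_eq_zero.mp constant)

theorem eventually_add_notMem_periodLattice {a : ℂ} (ha : a ∉ L.lattice) :
    ∀ᶠ z in 𝓝 (0 : ℂ), z + a ∉ L.lattice :=
  (continuous_add_const a).continuousAt.eventually_mem
    ((isOpen_compl_periodLattice L).mem_nhds (by rwa [zero_add]))

theorem eventually_weierstrassP_add_eq {a b : ℂ} (ha : a ∉ L.lattice) (hb : b ∉ L.lattice)
    (h : L.weierstrassP a = L.weierstrassP b)
    (h' : L.derivWeierstrassP a = L.derivWeierstrassP b) :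
    ∀ᶠ z in 𝓝 (0 : ℂ), L.weierstrassP (z + a) = L.weierstrassP (z + b) := by
  set f : ℂ → ℂ := fun z => L.weierstrassP (z + a)
  set g : ℂ → ℂ := fun z => L.weierstrassP (z + b)
  have analytic_f : AnalyticAt ℂ f 0 :=
    (L.analyticOnNhd_weierstrassP a ha).comp_of_eq (by fun_prop) (zero_add a)
  have analytic_g : AnalyticAt ℂ g 0 :=
    (L.analyticOnNhd_weierstrassP b hb).comp_of_eq (by fun_prop) (zero_add b)
  have near := (eventually_add_notMem_periodLattice ha).and (eventually_add_notMem_periodLattice hb)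
  have deriv_sub : ∀ᶠ z in 𝓝 (0 : ℂ), deriv (f - g) z =
      L.derivWeierstrassP (z + a) - L.derivWeierstrassP (z + b) :=
    near.mono fun z hz => (((hasDerivAt_weierstrassP hz.1).comp_add_const z a).sub
      ((hasDerivAt_weierstrassP hz.2).comp_add_const z b)).deriv
  -- `℘'' = 6 ℘² - g₂ / 2` makes `f - g` a solution of a linear equation.
  have ode : ∀ᶠ z in 𝓝 (0 : ℂ), deriv (deriv (f - g)) z = 6 * (f z + g z) * (f - g) z := by
    filter_upwards [near, deriv_sub.eventually_nhds] with z hz hderiv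
    rw [EventuallyEq.deriv_eq hderiv,
      (((hasDerivAt_derivWeierstrassP hz.1).comp_add_const z a).fun_sub
        ((hasDerivAt_derivWeierstrassP hz.2).comp_add_const z b)).deriv]
    simp only [f, g, Pi.sub_apply]
    ring
  have eventually_zero : ∀ᶠ z in 𝓝 (0 : ℂ), (f - g) z = 0 :=
    eventually_eq_zero_of_deriv_deriv_eq_mul (analytic_f.sub analytic_g)
      (analyticAt_const.mul (analytic_f.add analytic_g)) (by simp [f, g, h])
      (by rw [deriv_sub.self_of_nhds]; simp [h']) ode
  exact eventually_zero.mono fun z hz => sub_eq_zero.mp hz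

theorem weierstrassP_add_eqOn {a b : ℂ} (ha : a ∉ L.lattice) (hb : b ∉ L.lattice)
    (h : L.weierstrassP a = L.weierstrassP b)
    (h' : L.derivWeierstrassP a = L.derivWeierstrassP b) :
    {z | z + a ∉ L.lattice ∧ z + b ∉ L.lattice}.EqOn
      (fun z => L.weierstrassP (z + a)) (fun z => L.weierstrassP (z + b)) := by
  have preconnected : IsPreconnected {z | z + a ∉ L.lattice ∧ z + b ∉ L.lattice} := by
    have := isPreconnected_compl_of_countable
      (((countable_periodLattice L).preimage (add_left_injective a)).union
        ((countable_periodLattice L).preimage (add_left_injective b)))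
    rwa [Set.compl_union] at this
  refine AnalyticOnNhd.eqOn_of_preconnected_of_eventuallyEq
    (fun z hz => (L.analyticOnNhd_weierstrassP _ hz.1).comp_of_eq (by fun_prop) rfl)
    (fun z hz => (L.analyticOnNhd_weierstrassP _ hz.2).comp_of_eq (by fun_prop) rfl)
    preconnected (z₀ := 0) ⟨?_, ?_⟩ (eventually_weierstrassP_add_eq ha hb h h')
  · rwa [zero_add]
  · rwa [zero_add]

theorem sub_mem_periodLattice_of_weierstrassP_eq {a b : ℂ} (ha : a ∉ L.lattice)
    (hb : b ∉ L.lattice) (h : L.weierstrassP a = L.weierstrassP b)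
    (h' : L.derivWeierstrassP a = L.derivWeierstrassP b) : b - a ∈ L.lattice := by
  -- Otherwise `℘` would agree, near its pole `0`, with the function `℘ (· + (b - a))`.
  by_contra hab
  have continuousAt_translate : ContinuousAt (fun z => L.weierstrassP (z + (b - a))) 0 :=
    ContinuousAt.comp_of_eq (L.analyticOnNhd_weierstrassP _ hab).continuousAt (by fun_prop)
      (zero_add _)
  refine (tendsto_weierstrassP_cobounded L.lattice.zero_mem).not_tendsto
    (Metric.disjoint_cobounded_nhds _)
    ((continuousAt_translate.tendsto.mono_left nhdsWithin_le_nhds).congr' ?_)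
  filter_upwards [(eventually_add_notMem_periodLattice hab).filter_mono nhdsWithin_le_nhds,
    eventually_notMem_periodLattice L 0] with z htranslate hz
  have translate_eq : z - a + b = z + (b - a) := by ring
  have := weierstrassP_add_eqOn ha hb h h' (x := z - a)
    ⟨by rwa [sub_add_cancel], by rwa [translate_eq]⟩
  simpa only [sub_add_cancel, translate_eq] using this.symm

theorem g₃_ne_zero_of_g₂_eq_zero (hg₂ : L.g₂ = 0) : L.g₃ ≠ 0 := by
  -- If both vanished, then `℘` and `℘'` would vanish together, whence `℘ = 0` by `℘'' = 6 ℘²`.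
  intro hg₃
  obtain ⟨a, ha, value⟩ := exists_weierstrassP_eq (L := L) 0
  have slope : L.derivWeierstrassP a = 0 := by
    simpa [value, hg₂, hg₃] using L.derivWeierstrassP_sq a ha
  have eventually_zero : ∀ᶠ z in 𝓝 a, L.weierstrassP z = 0 := by
    refine eventually_eq_zero_of_deriv_deriv_eq_mul (k := fun z => 6 * L.weierstrassP z)
      (L.analyticOnNhd_weierstrassP a ha)
      (analyticAt_const.mul (L.analyticOnNhd_weierstrassP a ha)) value
      (by rw [L.deriv_weierstrassP, slope]) ?_
    filter_upwards [(isOpen_compl_periodLattice L).mem_nhds ha] with z hz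
    rw [L.deriv_weierstrassP, (hasDerivAt_derivWeierstrassP hz).deriv, hg₂]
    ring
  have zero_off_lattice :=
    L.analyticOnNhd_weierstrassP.eqOn_zero_of_preconnected_of_eventuallyEq_zero
      (isPreconnected_compl_of_countable (countable_periodLattice L)) ha eventually_zero
  obtain ⟨z, hz, hzL⟩ := (((tendsto_weierstrassP_cobounded L.lattice.zero_mem
    ).eventually_ne_cobounded 0).and (eventually_notMem_periodLattice L 0)).exists
  exact hz (zero_off_lattice hzL)

end Weierstrass

/-! ### The group generated by `-ω` -/

theorem omega_pow_three : omega ^ 3 = 1 := by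
  linear_combination (omega - 1) * omega_sq

theorem omega_ne_one : omega ≠ 1 := by
  intro h
  have := omega_sq
  rw [h] at this
  norm_num at this

theorem negOmega_val : (negOmega : ℂ) = -omega := rfl

theorem isPrimitiveRoot_negOmega : IsPrimitiveRoot negOmega 6 := by
  have cube : negOmega ^ 3 = -1 := by
    ext
    rw [Units.val_pow_eq_pow_val, negOmega_val, Units.val_neg, Units.val_one]
    linear_combination -omega_pow_three
  rw [IsPrimitiveRoot.iff_orderOf]
  refine orderOf_eq_of_pow_and_pow_div_prime (by norm_num) ?_ fun p hp hdvd => ?_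
  · rw [show 6 = 3 * 2 from rfl, pow_mul, cube, neg_one_sq]
  · have hp' : p = 2 ∨ p = 3 := by
      rw [show 6 = 2 * 3 from rfl, hp.dvd_mul, Nat.prime_dvd_prime_iff_eq hp Nat.prime_two,
        Nat.prime_dvd_prime_iff_eq hp Nat.prime_three] at hdvd
      exact hdvd
    rcases hp' with rfl | rfl
    · rw [show 6 / 2 = 3 from rfl, cube]
      exact fun h => absurd (congrArg Units.val h) (by norm_num)
    · intro h
      have sq_eq_one : (-omega) ^ 2 = 1 := by simpa [negOmega_val] using congrArg Units.val h
      exact omega_ne_one (by linear_combination omega_pow_three - omega * sq_eq_one)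

theorem mem_G_iff {ζ : ℂˣ} : ζ ∈ G ↔ (ζ : ℂ) ^ 6 = 1 := by
  rw [G, isPrimitiveRoot_negOmega.zpowers_eq, mem_rootsOfUnity, Units.ext_iff]
  simp

theorem exists_eq_negOmega_pow {ζ : ℂˣ} (hζ : ζ ∈ G) : ∃ n : ℕ, ζ = negOmega ^ n := by
  rw [G, isPrimitiveRoot_negOmega.zpowers_eq] at hζ
  obtain ⟨n, -, hn⟩ := isPrimitiveRoot_negOmega.eq_pow_of_mem_rootsOfUnity hζ
  exact ⟨n, hn.symm⟩

theorem exists_mem_G_pow_eq {ξ ε : ℂ} (hξ : ξ ^ 3 = 1) (hε : ε ^ 2 = 1) :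
    ∃ ζ ∈ G, (ζ : ℂ) ^ 4 = ξ ∧ (ζ : ℂ) ^ 3 = ε := by
  have hpow : (ξ * ε) ^ 6 = 1 := by
    linear_combination ε ^ 6 * (ξ ^ 3 + 1) * hξ + (ε ^ 4 + ε ^ 2 + 1) * hε
  refine ⟨Units.ofPowEqOne (ξ * ε) 6 hpow (by norm_num), mem_G_iff.mpr hpow, ?_, ?_⟩
  · rw [Units.val_ofPowEqOne]
    linear_combination ξ * ε ^ 4 * hξ + ξ * (ε ^ 2 + 1) * hε
  · rw [Units.val_ofPowEqOne]
    linear_combination ε ^ 3 * hξ + ε * hε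

/-! ### Elliptic functions of the lattice `ℤ + ℤω` -/

/-- The pair of periods `(1, ω)`, which spans `lattice`. -/
def periods : PeriodPair where
  ω₁ := 1
  ω₂ := omega
  indep := by
    have omega_im : omega.im = Real.sqrt 3 / 2 := by simp [omega]
    rw [LinearIndependent.pair_iff]
    intro s t h
    obtain rfl : t = 0 := by simpa [omega_im] using congrArg Complex.im h
    exact ⟨by simpa using h, rfl⟩

theorem mem_periods_lattice {z : ℂ} : z ∈ periods.lattice ↔ z ∈ lattice := by
  rw [lattice, AddSubgroup.mem_closure_pair, PeriodPair.mem_lattice]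
  simp [periods]

theorem coe_periods_lattice : (periods.lattice : Set ℂ) = lattice :=
  Set.ext fun _ => mem_periods_lattice

theorem isOpen_compl_lattice : IsOpen ((lattice : Set ℂ)ᶜ) :=
  coe_periods_lattice ▸ isOpen_compl_periodLattice periods

theorem countable_lattice : (lattice : Set ℂ).Countable :=
  coe_periods_lattice ▸ countable_periodLattice periods

theorem eventually_notMem_lattice (l : ℂ) : ∀ᶠ z in 𝓝[≠] l, z ∉ lattice := by
  simpa only [mem_periods_lattice] using eventually_notMem_periodLattice periods l

theorem mem_lattice_iff_of_coe_eq {ζ : ℂˣ} (hζ : ζ ∈ G) {z w : ℂ}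
    (h : (w : Eomega) = ((ζ * z : ℂ) : Eomega)) : w ∈ lattice ↔ z ∈ lattice := by
  have hsub : -w + ζ * z ∈ lattice := QuotientAddGroup.eq.mp h
  constructor
  · intro hw
    simpa using unit_mul_mem_lattice (G.inv_mem hζ) (lattice.add_mem hw hsub)
  · intro hz
    simpa using lattice.sub_mem (unit_mul_mem_lattice hζ hz) hsub

/-- An elliptic function `p` for `lattice` with a pole at every lattice point and nowhere else, on
which `⟨-ω⟩` acts through the character `ζ ↦ ζ ^ k`. As for Mathlib's `℘`, the value of `p` at the
poles is `0`. -/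
structure IsWeightedElliptic (k : ℕ) (p : ℂ → ℂ) : Prop where
  analyticAt : ∀ z ∉ lattice, AnalyticAt ℂ p z
  tendsto_cobounded : ∀ l ∈ lattice, Tendsto p (𝓝[≠] l) (cobounded ℂ)
  apply_of_mem : ∀ l ∈ lattice, p l = 0
  apply_add : ∀ z, ∀ l ∈ lattice, p (z + l) = p z
  apply_negOmega_mul : ∀ z, p (negOmega * z) = (negOmega : ℂ) ^ k * p z

namespace IsWeightedElliptic

variable {k : ℕ} {p : ℂ → ℂ}

theorem const_mul (hp : IsWeightedElliptic k p) {c : ℂ} (hc : c ≠ 0) :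
    IsWeightedElliptic k fun z => c * p z where
  analyticAt z hz := analyticAt_const.mul (hp.analyticAt z hz)
  tendsto_cobounded l hl :=
    (tendsto_mul_left_cobounded hc).comp (hp.tendsto_cobounded l hl)
  apply_of_mem l hl := by rw [hp.apply_of_mem l hl, mul_zero]
  apply_add z l hl := by rw [hp.apply_add z l hl]
  apply_negOmega_mul z := by rw [hp.apply_negOmega_mul, mul_left_comm]

theorem notMem_of_ne_zero (hp : IsWeightedElliptic k p) {z : ℂ} (hz : p z ≠ 0) : z ∉ lattice :=
  fun hmem => hz (hp.apply_of_mem z hmem)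

theorem eventually_ne_zero (hp : IsWeightedElliptic k p) {l : ℂ} (hl : l ∈ lattice) :
    ∀ᶠ z in 𝓝[≠] l, p z ≠ 0 :=
  (hp.tendsto_cobounded l hl).eventually_ne_cobounded 0

theorem analyticAt_inv (hp : IsWeightedElliptic k p) {l : ℂ} (hl : l ∈ lattice) :
    AnalyticAt ℂ p⁻¹ l :=
  analyticAt_inv_of_tendsto_cobounded
    ((eventually_notMem_lattice l).mono fun z hz => (hp.analyticAt z hz).differentiableAt)
    (hp.tendsto_cobounded l hl) (hp.apply_of_mem l hl)

theorem apply_unit_mul (hp : IsWeightedElliptic k p) {ζ : ℂˣ} (hζ : ζ ∈ G) (z : ℂ) :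
    p (ζ * z) = (ζ : ℂ) ^ k * p z := by
  obtain ⟨n, rfl⟩ := exists_eq_negOmega_pow hζ
  clear hζ
  induction n with
  | zero => simp
  | succ n ih =>
    rw [pow_succ', Units.val_mul, mul_assoc, hp.apply_negOmega_mul, ih, mul_pow, mul_assoc]

theorem apply_eq_of_coe_eq (hp : IsWeightedElliptic k p) {ζ : ℂˣ} (hζ : ζ ∈ G) {z w : ℂ}
    (h : (w : Eomega) = ((ζ * z : ℂ) : Eomega)) : p w = (ζ : ℂ) ^ k * p z := by
  have hl : -w + ζ * z ∈ lattice := QuotientAddGroup.eq.mp h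
  rw [← hp.apply_unit_mul hζ, ← hp.apply_add w _ hl, add_neg_cancel_left]

end IsWeightedElliptic

theorem omega_mul_mem_iff {z : ℂ} : omega * z ∈ lattice ↔ z ∈ lattice := by
  have negOmega_mem : negOmega ∈ G := Subgroup.mem_zpowers _
  constructor
  · intro h
    have := unit_mul_mem_lattice (G.inv_mem negOmega_mem) (lattice.neg_mem h)
    rwa [← neg_mul, ← negOmega_val, Units.inv_mul_cancel_left] at this
  · intro h
    simpa [negOmega_val] using unit_mul_mem_lattice negOmega_mem (lattice.neg_mem h)

/-- Multiplication by `ω` as a permutation of the lattice, for reindexing lattice sums. -/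
def omegaEquiv : periods.lattice ≃ periods.lattice :=
  (Equiv.mulLeft₀ omega fun h => by simpa [h] using omega_pow_three).subtypeEquiv fun z => by
    rw [mem_periods_lattice, mem_periods_lattice]
    exact omega_mul_mem_iff.symm

theorem omegaEquiv_coe (l : periods.lattice) : (omegaEquiv l : ℂ) = omega * l := rfl

theorem omega_inv : omega⁻¹ = omega ^ 2 :=
  inv_eq_of_mul_eq_one_right (by rw [← pow_succ', omega_pow_three])

theorem periods_g₂ : periods.g₂ = 0 := by
  have invariance : periods.G 4 = omega⁻¹ * periods.G 4 := by
    conv_lhs => rw [PeriodPair.G, ← omegaEquiv.tsum_eq]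
    rw [PeriodPair.G, ← tsum_mul_left]
    refine tsum_congr fun l => ?_
    rw [omegaEquiv_coe, mul_pow, mul_inv, pow_succ omega 3, omega_pow_three, one_mul]
  have G_four : periods.G 4 = 0 := by
    by_contra hne
    exact omega_ne_one (inv_eq_one.mp (mul_eq_right₀ hne |>.mp invariance.symm))
  rw [PeriodPair.g₂, G_four, mul_zero]

theorem periods_g₃_ne_zero : periods.g₃ ≠ 0 := g₃_ne_zero_of_g₂_eq_zero periods_g₂

theorem weierstrassP_omega_mul (z : ℂ) :
    periods.weierstrassP (omega * z) = omega * periods.weierstrassP z := by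
  conv_lhs => rw [PeriodPair.weierstrassP, ← omegaEquiv.tsum_eq]
  rw [PeriodPair.weierstrassP, ← tsum_mul_left]
  refine tsum_congr fun l => ?_
  have inv_sq : (omega ^ 2)⁻¹ = omega := by rw [← omega_inv, inv_inv]
  rw [omegaEquiv_coe, ← mul_sub, mul_pow, mul_pow]
  simp only [one_div, mul_inv, inv_sq]
  ring

theorem derivWeierstrassP_omega_mul (z : ℂ) :
    periods.derivWeierstrassP (omega * z) = periods.derivWeierstrassP z := by
  conv_lhs => rw [PeriodPair.derivWeierstrassP, ← omegaEquiv.tsum_eq]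
  rw [PeriodPair.derivWeierstrassP]
  congr 1
  refine tsum_congr fun l => ?_
  rw [omegaEquiv_coe, ← mul_sub, mul_pow, omega_pow_three, one_mul]

theorem isWeightedElliptic_weierstrassP : IsWeightedElliptic 4 periods.weierstrassP where
  analyticAt z hz := periods.analyticOnNhd_weierstrassP z (mem_periods_lattice.not.mpr hz)
  tendsto_cobounded l hl := tendsto_weierstrassP_cobounded (mem_periods_lattice.mpr hl)
  apply_of_mem l hl := periods.weierstrassP_coe ⟨l, mem_periods_lattice.mpr hl⟩
  apply_add z l hl := periods.weierstrassP_add_coe z ⟨l, mem_periods_lattice.mpr hl⟩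
  apply_negOmega_mul z := by
    rw [negOmega_val, neg_mul, periods.weierstrassP_neg, weierstrassP_omega_mul]
    linear_combination -omega * periods.weierstrassP z * omega_pow_three

theorem isWeightedElliptic_derivWeierstrassP :
    IsWeightedElliptic 3 periods.derivWeierstrassP where
  analyticAt z hz := periods.analyticOnNhd_derivWeierstrassP z (mem_periods_lattice.not.mpr hz)
  tendsto_cobounded l hl := tendsto_derivWeierstrassP_cobounded (mem_periods_lattice.mpr hl)
  apply_of_mem l hl := periods.derivWeierstrassP_coe ⟨l, mem_periods_lattice.mpr hl⟩
  apply_add z l hl := periods.derivWeierstrassP_add_coe z ⟨l, mem_periods_lattice.mpr hl⟩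
  apply_negOmega_mul z := by
    rw [negOmega_val, neg_mul, periods.derivWeierstrassP_neg, derivWeierstrassP_omega_mul]
    linear_combination periods.derivWeierstrassP z * omega_pow_three

/-! ### The curve `y² = x³ + 1` -/

/-- The factor that normalises `℘`; any cube root of `-4 / g₃` would do. -/
def xScale : ℂ := (-4 / periods.g₃) ^ ((3 : ℕ) : ℂ)⁻¹

/-- The factor that normalises `℘'`; any square root of `-1 / g₃` would do. -/
def yScale : ℂ := (-1 / periods.g₃) ^ ((2 : ℕ) : ℂ)⁻¹

theorem xScale_pow : xScale ^ 3 = -4 / periods.g₃ := Complex.cpow_nat_inv_pow _ three_ne_zero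

theorem yScale_pow : yScale ^ 2 = -1 / periods.g₃ := Complex.cpow_nat_inv_pow _ two_ne_zero

theorem xScale_ne_zero : xScale ≠ 0 :=
  (pow_ne_zero_iff three_ne_zero).mp (by simp [xScale_pow, periods_g₃_ne_zero])

theorem yScale_ne_zero : yScale ≠ 0 :=
  (pow_ne_zero_iff two_ne_zero).mp (by simp [yScale_pow, periods_g₃_ne_zero])

/-- The coordinate `x` of `E_ω`, embedded as the curve `y² = x³ + 1`, as an elliptic function; its
value at the lattice points, which correspond to the point at infinity, is `0`. -/
def px (z : ℂ) : ℂ := xScale * periods.weierstrassP z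

/-- The coordinate `y` of `E_ω`, embedded as the curve `y² = x³ + 1`, as an elliptic function; its
value at the lattice points, which correspond to the point at infinity, is `0`. -/
def py (z : ℂ) : ℂ := yScale * periods.derivWeierstrassP z

theorem isWeightedElliptic_px : IsWeightedElliptic 4 px :=
  isWeightedElliptic_weierstrassP.const_mul xScale_ne_zero

theorem isWeightedElliptic_py : IsWeightedElliptic 3 py :=
  isWeightedElliptic_derivWeierstrassP.const_mul yScale_ne_zero

theorem py_sq {z : ℂ} (hz : z ∉ lattice) : py z ^ 2 = px z ^ 3 + 1 := by
  have relation := periods.derivWeierstrassP_sq z (mem_periods_lattice.not.mpr hz)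
  have := periods_g₃_ne_zero
  rw [px, py, mul_pow, mul_pow, xScale_pow, yScale_pow, relation, periods_g₂]
  field_simp
  ring

theorem deriv_px_ne_zero {z : ℂ} (hy : py z ≠ 0) : deriv px z ≠ 0 := by
  have hz := mem_periods_lattice.not.mpr (isWeightedElliptic_py.notMem_of_ne_zero hy)
  rw [HasDerivAt.deriv (f := px) ((hasDerivAt_weierstrassP hz).const_mul xScale)]
  exact mul_ne_zero xScale_ne_zero (right_ne_zero_of_mul hy)

theorem deriv_py_ne_zero {z : ℂ} (hx : px z ≠ 0) : deriv py z ≠ 0 := by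
  have hz := mem_periods_lattice.not.mpr (isWeightedElliptic_px.notMem_of_ne_zero hx)
  rw [HasDerivAt.deriv (f := py) ((hasDerivAt_derivWeierstrassP hz).const_mul yScale), periods_g₂]
  have := right_ne_zero_of_mul hx
  exact mul_ne_zero yScale_ne_zero (by simpa using this)

theorem sub_mem_lattice_of_px_eq_of_py_eq {a b : ℂ} (ha : a ∉ lattice) (hb : b ∉ lattice)
    (hx : px a = px b) (hy : py a = py b) : b - a ∈ lattice :=
  mem_periods_lattice.mp <| sub_mem_periodLattice_of_weierstrassP_eq
    (mem_periods_lattice.not.mpr ha) (mem_periods_lattice.not.mpr hb)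
    (mul_left_cancel₀ xScale_ne_zero hx) (mul_left_cancel₀ yScale_ne_zero hy)

theorem exists_px_eq_py_eq {x y : ℂ} (h : y ^ 2 = x ^ 3 + 1) :
    ∃ z ∉ lattice, px z = x ∧ py z = y := by
  obtain ⟨z, hz, hzx⟩ := exists_weierstrassP_eq (L := periods) (xScale⁻¹ * x)
  rw [mem_periods_lattice] at hz
  have hx : px z = x := by rw [px, hzx, mul_inv_cancel_left₀ xScale_ne_zero]
  have hy := py_sq hz
  rw [hx, ← h] at hy
  rcases sq_eq_sq_iff_eq_or_eq_neg.mp hy with hy | hy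
  · exact ⟨z, hz, hx, hy⟩
  · refine ⟨-z, by rwa [neg_mem_iff], ?_, ?_⟩
    · rw [px, periods.weierstrassP_neg, ← px, hx]
    · rw [py, periods.derivWeierstrassP_neg, mul_neg, ← py, hy, neg_neg]

/-! ### Local inverses -/

theorem exists_analyticAt_right_inverse {f : ℂ → ℂ} {a : ℂ} (hf : AnalyticAt ℂ f a)
    (hd : deriv f a ≠ 0) :
    ∃ φ : ℂ → ℂ, AnalyticAt ℂ φ (f a) ∧ φ (f a) = a ∧ ∀ᶠ x in 𝓝 (f a), f (φ x) = x :=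
  ⟨_, hf.analyticAt_localInverse hd, HasStrictFDerivAt.localInverse_apply_image ..,
    HasStrictDerivAt.eventually_right_inverse ..⟩

theorem exists_analyticAt_pow_eq {E : Type*} [NormedAddCommGroup E] [NormedSpace ℂ E] {f : E → ℂ}
    {x : E} (hf : AnalyticAt ℂ f x) {a : ℂ} (ha : a ≠ 0) {n : ℕ} (hn : n ≠ 0) (h : a ^ n = f x) :
    ∃ g : E → ℂ, AnalyticAt ℂ g x ∧ g x = a ∧ ∀ᶠ y in 𝓝 x, g y ^ n = f y := by
  obtain ⟨φ, hφ, hφa, hφpow⟩ :=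
    exists_analyticAt_right_inverse (f := (· ^ n)) (a := a) (by fun_prop) (by simp [ha, hn])
  simp only [h] at hφ hφa hφpow
  exact ⟨φ ∘ f, hφ.comp hf, hφa, hf.continuousAt.eventually hφpow⟩

theorem eventually_eq_of_pow_eq {X : Type*} [TopologicalSpace X] {f g : X → ℂ} {x : X}
    (hf : ContinuousAt f x) (hg : ContinuousAt g x) (h : f x = g x) (h0 : g x ≠ 0) {n : ℕ}
    (hn : n ≠ 0) : ∀ᶠ y in 𝓝 x, f y ^ n = g y ^ n → f y = g y := by
  have deriv_ne_zero : (n : ℂ) * g x ^ (n - 1) ≠ 0 := by simp [h0, hn]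
  have left_inverse := (hasStrictDerivAt_pow n (g x)).eventually_left_inverse deriv_ne_zero
  filter_upwards [(h ▸ hf.tendsto).eventually left_inverse, hg.eventually left_inverse]
    with y hfy hgy hpow
  rw [← hfy, ← hgy, hpow]

theorem exists_local_parameter {a : ℂ} (ha : a ∉ lattice) :
    ∃ ψ : ℂ × ℂ → ℂ, AnalyticAt ℂ ψ (px a, py a) ∧ ψ (px a, py a) = a ∧
      ∀ᶠ P in 𝓝 (px a, py a), P.2 ^ 2 = P.1 ^ 3 + 1 → px (ψ P) = P.1 ∧ py (ψ P) = P.2 := by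
  have x_analytic := isWeightedElliptic_px.analyticAt a ha
  have y_analytic := isWeightedElliptic_py.analyticAt a ha
  have notMem : ∀ᶠ z in 𝓝 a, z ∉ lattice := isOpen_compl_lattice.mem_nhds ha
  by_cases hy : py a = 0
  · have hx : px a ≠ 0 := fun hx => by simpa [hx, hy] using py_sq ha
    obtain ⟨φ, hφ, hφa, hφy⟩ :=
      exists_analyticAt_right_inverse y_analytic (deriv_py_ne_zero hx)
    have hψ : AnalyticAt ℂ (fun P : ℂ × ℂ => φ P.2) (px a, py a) :=
      hφ.comp_of_eq analyticAt_snd rfl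
    have x_eq : ∀ᶠ P in 𝓝 (px a, py a), px (φ P.2) ^ 3 = P.1 ^ 3 → px (φ P.2) = P.1 :=
      eventually_eq_of_pow_eq (x_analytic.continuousAt.comp_of_eq hψ.continuousAt hφa)
        continuousAt_fst (congrArg px hφa) hx three_ne_zero
    refine ⟨fun P => φ P.2, hψ, hφa, ?_⟩
    filter_upwards [hψ.continuousAt.tendsto.eventually (hφa.symm ▸ notMem), x_eq,
      (continuousAt_snd (p := (px a, py a))).eventually hφy] with P hP hPx hPy hcurve
    refine ⟨hPx ?_, hPy⟩
    linear_combination hcurve - py_sq hP + (py (φ P.2) + P.2) * hPy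
  · obtain ⟨φ, hφ, hφa, hφx⟩ :=
      exists_analyticAt_right_inverse x_analytic (deriv_px_ne_zero hy)
    have hψ : AnalyticAt ℂ (fun P : ℂ × ℂ => φ P.1) (px a, py a) :=
      hφ.comp_of_eq analyticAt_fst rfl
    have y_eq : ∀ᶠ P in 𝓝 (px a, py a), py (φ P.1) ^ 2 = P.2 ^ 2 → py (φ P.1) = P.2 :=
      eventually_eq_of_pow_eq (y_analytic.continuousAt.comp_of_eq hψ.continuousAt hφa)
        continuousAt_snd (congrArg py hφa) hy two_ne_zero
    refine ⟨fun P => φ P.1, hψ, hφa, ?_⟩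
    filter_upwards [hψ.continuousAt.tendsto.eventually (hφa.symm ▸ notMem), y_eq,
      (continuousAt_fst (p := (px a, py a))).eventually hφx] with P hP hPy hPx hcurve
    refine ⟨hPx, hPy ?_⟩
    rw [hcurve, py_sq hP, hPx]

/-! ### The map to the hypersurface -/

/-- The points of `ℂ³` on which the map to the hypersurface is defined and a local isomorphism. -/
def regularLocus : Set C3 :=
  {z | (∀ i, z i ∉ lattice) ∧ px (z 2) ≠ 0 ∧ py (z 2) ≠ 0 ∧ py (z 0) ^ 2 ≠ py (z 2) ^ 2}

/-- The birational map of the theorem in the coordinates `(t, s, z, w)` of `𝔸⁴`, as a map on `ℂ³`: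
with `xᵢ = px (z i)` and `yᵢ = py (z i)`, it is `(y₀/y₂, y₁/y₂, x₀/x₂, x₁/x₂)`. -/
def ratioMap (z : C3) : Fin 4 → ℂ :=
  ![py (z 0) / py (z 2), py (z 1) / py (z 2), px (z 0) / px (z 2), px (z 1) / px (z 2)]

/-- The open subset of the hypersurface that turns out to be the image of `regularLocus`. -/
def regularImage : Set (Fin 4 → ℂ) :=
  {q | q ∈ hypersurfaceQ ∧ q 0 ^ 2 ≠ 1 ∧ q 2 ^ 3 ≠ 1 ∧ q 2 ^ 3 ≠ q 0 ^ 2}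

/-- The value of `x₂³` at a point whose ratios `y₀/y₂` and `x₀/x₂` are `q 0` and `q 2`: it solves
`(q 0)² y₂² = (q 2)³ x₂³ + 1` and `y₂² = x₂³ + 1`. -/
def xCube (q : Fin 4 → ℂ) : ℂ := (q 0 ^ 2 - 1) / (q 2 ^ 3 - q 0 ^ 2)

/-- The value of `y₂²` at a point whose ratios `y₀/y₂` and `x₀/x₂` are `q 0` and `q 2`. -/
def ySquare (q : Fin 4 → ℂ) : ℂ := (q 2 ^ 3 - 1) / (q 2 ^ 3 - q 0 ^ 2)

/-- The three points `(xᵢ, yᵢ)` with `(x₂, y₂) = (x, y)` and with the coordinates of `q` as their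
ratios. -/
def curvePoint (x y : ℂ) (q : Fin 4 → ℂ) : Fin 3 → ℂ × ℂ :=
  ![(q 2 * x, q 0 * y), (q 3 * x, q 1 * y), (x, y)]

theorem xCube_ne_zero {q : Fin 4 → ℂ} (hq : q ∈ regularImage) : xCube q ≠ 0 :=
  div_ne_zero (sub_ne_zero.mpr hq.2.1) (sub_ne_zero.mpr hq.2.2.2)

theorem ySquare_ne_zero {q : Fin 4 → ℂ} (hq : q ∈ regularImage) : ySquare q ≠ 0 :=
  div_ne_zero (sub_ne_zero.mpr hq.2.2.1) (sub_ne_zero.mpr hq.2.2.2)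

theorem curvePoint_mul_mul (ξ ε x y : ℂ) (q : Fin 4 → ℂ) (i : Fin 3) :
    curvePoint (ξ * x) (ε * y) q i = (ξ * (curvePoint x y q i).1, ε * (curvePoint x y q i).2) := by
  fin_cases i <;> simp [curvePoint, mul_left_comm]

theorem curvePoint_sq_eq {q : Fin 4 → ℂ} (hq : q ∈ regularImage) {x y : ℂ} (hx : x ^ 3 = xCube q)
    (hy : y ^ 2 = ySquare q) (i : Fin 3) :
    (curvePoint x y q i).2 ^ 2 = (curvePoint x y q i).1 ^ 3 + 1 := by
  have equation : (q 3 ^ 3 - 1) * (q 0 ^ 2 - 1) = (q 2 ^ 3 - 1) * (q 1 ^ 2 - 1) := hq.1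
  have denominator := sub_ne_zero.mpr hq.2.2.2
  fin_cases i <;> simp only [curvePoint, Fin.zero_eta, Fin.mk_one, Fin.reduceFinMk,
    Matrix.cons_val, mul_pow, hx, hy, xCube, ySquare] <;> field_simp
  · ring
  · linear_combination -equation
  · ring

theorem ratioMap_eq_of_eq_curvePoint {x y : ℂ} (hx : x ≠ 0) (hy : y ≠ 0) {q : Fin 4 → ℂ} {z : C3}
    (h : ∀ i, (px (z i), py (z i)) = curvePoint x y q i) : ratioMap z = q := by
  simp only [Prod.ext_iff, Fin.forall_fin_succ] at h
  ext k
  fin_cases k <;> simp_all [ratioMap, curvePoint]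

theorem eq_curvePoint_ratioMap {z : C3} (hz : z ∈ regularLocus) (i : Fin 3) :
    (px (z i), py (z i)) = curvePoint (px (z 2)) (py (z 2)) (ratioMap z) i := by
  obtain ⟨-, x_ne_zero, y_ne_zero, -⟩ := hz
  fin_cases i <;> simp [curvePoint, ratioMap, x_ne_zero, y_ne_zero]

theorem ratioMap_mem_regularImage {z : C3} (hz : z ∈ regularLocus) :
    ratioMap z ∈ regularImage := by
  obtain ⟨notMem, hx, hy, hne⟩ := hz
  have curve := fun i => py_sq (notMem i)
  simp only [regularImage, hypersurfaceQ, ratioMap, Set.mem_ofPred_eq, Matrix.cons_val]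
  refine ⟨?_, fun h => hne ?_, fun h => hne ?_, fun h => hne ?_⟩
  · field_simp
    linear_combination (px (z 1) ^ 3 - px (z 2) ^ 3) * (curve 0 - curve 2)
      - (px (z 0) ^ 3 - px (z 2) ^ 3) * (curve 1 - curve 2)
  · field_simp at h
    exact h
  · field_simp at h
    linear_combination h + curve 0 - curve 2
  · field_simp at h
    linear_combination h + py (z 2) ^ 2 * curve 0 - py (z 0) ^ 2 * curve 2

theorem px_pow_eq_xCube {z : C3} (hz : z ∈ regularLocus) :
    px (z 2) ^ 3 = xCube (ratioMap z) := by
  have denominator := sub_ne_zero.mpr (ratioMap_mem_regularImage hz).2.2.2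
  rw [xCube, eq_div_iff denominator]
  obtain ⟨notMem, hx, hy, -⟩ := hz
  simp only [ratioMap, Matrix.cons_val]
  field_simp
  linear_combination py (z 0) ^ 2 * py_sq (notMem 2) - py (z 2) ^ 2 * py_sq (notMem 0)

theorem py_pow_eq_ySquare {z : C3} (hz : z ∈ regularLocus) :
    py (z 2) ^ 2 = ySquare (ratioMap z) := by
  have denominator := sub_ne_zero.mpr (ratioMap_mem_regularImage hz).2.2.2
  rw [py_sq (hz.1 2), px_pow_eq_xCube hz, xCube, ySquare]
  field_simp
  ring

/-! ### Invariance -/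

section Invariance

variable {ζ : ℂˣ} {z w : C3}

theorem IsWeightedElliptic.apply_eq_of_toTorus_eq {k : ℕ} {p : ℂ → ℂ} (hp : IsWeightedElliptic k p)
    (hζ : ζ ∈ G) (h : toTorus w = toTorus ((ζ : ℂ) • z)) (i : Fin 3) :
    p (w i) = (ζ : ℂ) ^ k * p (z i) :=
  hp.apply_eq_of_coe_eq hζ (congrFun h i)

theorem regularLocus_iff_of_toTorus_eq (hζ : ζ ∈ G) (h : toTorus w = toTorus ((ζ : ℂ) • z)) :
    w ∈ regularLocus ↔ z ∈ regularLocus := by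
  have sq_eq_one : ((ζ : ℂ) ^ 3) ^ 2 = 1 := by rw [← pow_mul]; exact mem_G_iff.mp hζ
  have mem_lattice_iff : ∀ i, w i ∈ lattice ↔ z i ∈ lattice := fun i =>
    mem_lattice_iff_of_coe_eq hζ (congrFun h i)
  simp [regularLocus, mem_lattice_iff, mul_pow, sq_eq_one,
    isWeightedElliptic_px.apply_eq_of_toTorus_eq hζ h,
    isWeightedElliptic_py.apply_eq_of_toTorus_eq hζ h]

theorem ratioMap_of_toTorus_eq (hζ : ζ ∈ G) (h : toTorus w = toTorus ((ζ : ℂ) • z)) :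
    ratioMap w = ratioMap z := by
  simp only [ratioMap, isWeightedElliptic_px.apply_eq_of_toTorus_eq hζ h,
    isWeightedElliptic_py.apply_eq_of_toTorus_eq hζ h,
    mul_div_mul_left _ _ (pow_ne_zero _ ζ.ne_zero)]

theorem notMem_fixedPoints_of_mem_regularLocus (hz : z ∈ regularLocus) : z ∉ fixedPoints := by
  rintro ⟨ζ, hζ, hne, h⟩
  have pow_four : (ζ : ℂ) ^ 4 = 1 :=
    (mul_eq_right₀ hz.2.1).mp (isWeightedElliptic_px.apply_eq_of_toTorus_eq hζ h.symm 2).symm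
  have pow_three : (ζ : ℂ) ^ 3 = 1 :=
    (mul_eq_right₀ hz.2.2.1).mp (isWeightedElliptic_py.apply_eq_of_toTorus_eq hζ h.symm 2).symm
  refine hne (Units.ext ?_)
  rw [Units.val_one]
  linear_combination pow_four - ζ * pow_three

theorem exists_smul_of_ratioMap_eq (hz : z ∈ regularLocus) (hw : w ∈ regularLocus)
    (h : ratioMap w = ratioMap z) : ∃ ζ ∈ G, toTorus w = toTorus ((ζ : ℂ) • z) := by
  obtain ⟨ζ, hζ, hx, hy⟩ :
      ∃ ζ ∈ G, (ζ : ℂ) ^ 4 = px (w 2) / px (z 2) ∧ (ζ : ℂ) ^ 3 = py (w 2) / py (z 2) := by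
    refine exists_mem_G_pow_eq ?_ ?_
    · rw [div_pow, px_pow_eq_xCube hz, px_pow_eq_xCube hw, h,
        div_self (xCube_ne_zero (ratioMap_mem_regularImage hz))]
    · rw [div_pow, py_pow_eq_ySquare hz, py_pow_eq_ySquare hw, h,
        div_self (ySquare_ne_zero (ratioMap_mem_regularImage hz))]
  rw [eq_div_iff hz.2.1] at hx
  rw [eq_div_iff hz.2.2.1] at hy
  refine ⟨ζ, hζ, toTorus_eq_iff.mpr fun i => ?_⟩
  have scaled : (px (w i), py (w i)) = ((ζ : ℂ) ^ 4 * px (z i), (ζ : ℂ) ^ 3 * py (z i)) := by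
    rw [eq_curvePoint_ratioMap hw, h, ← hx, ← hy, curvePoint_mul_mul, ← eq_curvePoint_ratioMap hz]
  rw [Prod.mk.injEq, ← isWeightedElliptic_px.apply_unit_mul hζ,
    ← isWeightedElliptic_py.apply_unit_mul hζ] at scaled
  have smul_notMem : ζ * z i ∉ lattice :=
    (mem_lattice_iff_of_coe_eq hζ rfl).not.mpr (hz.1 i)
  exact sub_mem_lattice_of_px_eq_of_py_eq (hw.1 i) smul_notMem scaled.1 scaled.2

end Invariance

theorem exists_ratioMap_eq {q : Fin 4 → ℂ} (hq : q ∈ regularImage) :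
    ∃ z ∈ regularLocus, ratioMap z = q := by
  obtain ⟨x, hx⟩ : ∃ x : ℂ, x ^ 3 = xCube q := IsAlgClosed.exists_pow_nat_eq _ three_pos
  obtain ⟨y, hy⟩ : ∃ y : ℂ, y ^ 2 = ySquare q := IsAlgClosed.exists_pow_nat_eq _ two_pos
  have x_ne_zero : x ≠ 0 := by rintro rfl; exact xCube_ne_zero hq (by rw [← hx]; simp)
  have y_ne_zero : y ≠ 0 := by rintro rfl; exact ySquare_ne_zero hq (by rw [← hy]; simp)
  choose z notMem hzx hzy using fun i => exists_px_eq_py_eq (curvePoint_sq_eq hq hx hy i)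
  refine ⟨z, ⟨notMem, ?_, ?_, ?_⟩,
    ratioMap_eq_of_eq_curvePoint x_ne_zero y_ne_zero fun i => Prod.ext (hzx i) (hzy i)⟩
  · rw [hzx]; exact x_ne_zero
  · rw [hzy]; exact y_ne_zero
  · have hne : q 0 ^ 2 * y ^ 2 ≠ y ^ 2 := fun h =>
      hq.2.1 ((mul_eq_right₀ (pow_ne_zero 2 y_ne_zero)).mp h)
    rw [hzy, hzy]
    simpa [curvePoint, mul_pow] using hne

theorem analyticAt_apply {ι : Type*} [Fintype ι] (i : ι) (z : ι → ℂ) :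
    AnalyticAt ℂ (fun w : ι → ℂ => w i) z :=
  (ContinuousLinearMap.proj (R := ℂ) (φ := fun _ : ι => ℂ) i).analyticAt z

theorem IsWeightedElliptic.analyticAt_comp_apply {k : ℕ} {p : ℂ → ℂ} (hp : IsWeightedElliptic k p)
    {ι : Type*} [Fintype ι] {z : ι → ℂ} {i : ι} (hz : z i ∉ lattice) :
    AnalyticAt ℂ (fun w : ι → ℂ => p (w i)) z :=
  (hp.analyticAt _ hz).comp_of_eq (analyticAt_apply i z) rfl

theorem isOpen_regularLocus : IsOpen regularLocus := by
  refine isOpen_iff_mem_nhds.mpr fun z ⟨notMem, hx, hy, hne⟩ => ?_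
  have px_continuousAt := fun i => (isWeightedElliptic_px.analyticAt_comp_apply
    (notMem i)).continuousAt
  have py_continuousAt := fun i => (isWeightedElliptic_py.analyticAt_comp_apply
    (notMem i)).continuousAt
  have eventually_notMem : ∀ᶠ w : C3 in 𝓝 z, ∀ i, w i ∉ lattice := eventually_all.mpr
    fun i => (continuous_apply i).continuousAt.eventually_mem
      (isOpen_compl_lattice.mem_nhds (notMem i))
  filter_upwards [eventually_notMem, (px_continuousAt 2).eventually_ne hx,
    (py_continuousAt 2).eventually_ne hy,
    (((py_continuousAt 0).pow 2).sub ((py_continuousAt 2).pow 2)).eventually_ne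
      (sub_ne_zero.mpr hne)]
    with w hw hwx hwy hwne
  exact ⟨hw, hwx, hwy, sub_ne_zero.mp hwne⟩

theorem analyticAt_ratioMap {z : C3} (hz : z ∈ regularLocus) : AnalyticAt ℂ ratioMap z := by
  obtain ⟨notMem, hx, hy, -⟩ := hz
  have px_analyticAt := fun i => isWeightedElliptic_px.analyticAt_comp_apply (notMem i)
  have py_analyticAt := fun i => isWeightedElliptic_py.analyticAt_comp_apply (notMem i)
  refine analyticAt_pi_iff.mpr fun k => ?_
  fin_cases k
  · exact (py_analyticAt 0).div (py_analyticAt 2) hy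
  · exact (py_analyticAt 1).div (py_analyticAt 2) hy
  · exact (px_analyticAt 0).div (px_analyticAt 2) hx
  · exact (px_analyticAt 1).div (px_analyticAt 2) hx

theorem analyticAt_xCube {q : Fin 4 → ℂ} (hq : q ∈ regularImage) : AnalyticAt ℂ xCube q :=
  (((analyticAt_apply 0 q).pow 2).sub analyticAt_const).div
    (((analyticAt_apply 2 q).pow 3).sub ((analyticAt_apply 0 q).pow 2)) (sub_ne_zero.mpr hq.2.2.2)

theorem analyticAt_ySquare {q : Fin 4 → ℂ} (hq : q ∈ regularImage) : AnalyticAt ℂ ySquare q :=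
  (((analyticAt_apply 2 q).pow 3).sub analyticAt_const).div
    (((analyticAt_apply 2 q).pow 3).sub ((analyticAt_apply 0 q).pow 2)) (sub_ne_zero.mpr hq.2.2.2)

theorem analyticAt_curvePoint {X Y : (Fin 4 → ℂ) → ℂ} {q : Fin 4 → ℂ} (hX : AnalyticAt ℂ X q)
    (hY : AnalyticAt ℂ Y q) (i : Fin 3) :
    AnalyticAt ℂ (fun q' => curvePoint (X q') (Y q') q' i) q := by
  fin_cases i
  · exact ((analyticAt_apply 2 q).mul hX).prod ((analyticAt_apply 0 q).mul hY)
  · exact ((analyticAt_apply 3 q).mul hX).prod ((analyticAt_apply 1 q).mul hY)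
  · exact hX.prod hY

theorem exists_local_section {z : C3} (hz : z ∈ regularLocus) :
    ∃ Ψ : (Fin 4 → ℂ) → C3, AnalyticAt ℂ Ψ (ratioMap z) ∧ Ψ (ratioMap z) = z ∧
      ∀ᶠ q in 𝓝 (ratioMap z), q ∈ regularImage → ratioMap (Ψ q) = q := by
  have hmem := ratioMap_mem_regularImage hz
  obtain ⟨notMem, hx, hy, -⟩ := id hz
  obtain ⟨X, hX, hXz, hXpow⟩ :=
    exists_analyticAt_pow_eq (analyticAt_xCube hmem) hx three_ne_zero (px_pow_eq_xCube hz)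
  obtain ⟨Y, hY, hYz, hYpow⟩ :=
    exists_analyticAt_pow_eq (analyticAt_ySquare hmem) hy two_ne_zero (py_pow_eq_ySquare hz)
  choose ψ hψ hψz hψcurve using fun i => exists_local_parameter (notMem i)
  have point_analytic := analyticAt_curvePoint hX hY
  have point_eq : ∀ i, curvePoint (X (ratioMap z)) (Y (ratioMap z)) (ratioMap z) i =
      (px (z i), py (z i)) := fun i => by rw [hXz, hYz, ← eq_curvePoint_ratioMap hz]
  refine ⟨fun q i => ψ i (curvePoint (X q) (Y q) q i), ?_, ?_, ?_⟩
  · exact analyticAt_pi_iff.mpr fun i => (hψ i).comp_of_eq (point_analytic i) (point_eq i)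
  · exact funext fun i => (congrArg (ψ i) (point_eq i)).trans (hψz i)
  · have inverse := eventually_all.mpr fun i =>
      (point_eq i ▸ (point_analytic i).continuousAt.tendsto).eventually (hψcurve i)
    filter_upwards [hXpow, hYpow, hX.continuousAt.eventually_ne (hXz.trans_ne hx),
      hY.continuousAt.eventually_ne (hYz.trans_ne hy), inverse] with q hqX hqY hX0 hY0 hq hqmem
    exact ratioMap_eq_of_eq_curvePoint hX0 hY0 fun i =>
      Prod.ext_iff.mpr (hq i (curvePoint_sq_eq hqmem hqX hqY i))

/-! ### Density -/

theorem exists_eq_mul_of_mul_eq_mul {K : Type*} [Field K] {a b c d : K} (h : c * b = a * d) :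
    ∃ l m v w : K, a = l * v ∧ b = l * w ∧ c = m * v ∧ d = m * w := by
  by_cases ha : a = 0
  · by_cases hb : b = 0
    · exact ⟨0, 1, c, d, by simp [ha], by simp [hb], by simp, by simp⟩
    · exact ⟨1, d / b, a, b, by simp, by simp, by field_simp; linear_combination h,
        by field_simp⟩
  · exact ⟨1, c / a, a, b, by simp, by simp, by field_simp, by field_simp; linear_combination -h⟩

theorem eventually_add_mul_ne_zero (x : ℂ) {k : ℂ} (hk : k ≠ 0) :
    ∀ᶠ ε in 𝓝[≠] (0 : ℂ), x + k * ε ≠ 0 := by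
  rcases eq_or_ne x 0 with rfl | hx
  · filter_upwards [self_mem_nhdsWithin] with ε hε
    simpa [hk] using hε
  · have : ContinuousAt (fun ε : ℂ => x + k * ε) 0 := by fun_prop
    exact (this.eventually_ne (by simpa using hx)).filter_mono nhdsWithin_le_nhds

/-- The quadric cone `a₃ a₀ = a₂ a₁`. The hypersurface is its inverse image under `powSubOne`. -/
def quadricCone : Set (Fin 4 → ℂ) := {a | a 3 * a 0 = a 2 * a 1}

/-- The open subset of the quadric cone whose inverse image under `powSubOne` is
`regularImage`. -/
def regularCone : Set (Fin 4 → ℂ) := {a | a ∈ quadricCone ∧ a 0 ≠ 0 ∧ a 2 ≠ 0 ∧ a 2 ≠ a 0}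

/-- The map `(t, s, z, w) ↦ (t² - 1, s² - 1, z³ - 1, w³ - 1)`. -/
def powSubOne : (Fin 4 → ℂ) → Fin 4 → ℂ :=
  Pi.map ![(· ^ 2 - 1), (· ^ 2 - 1), (· ^ 3 - 1), (· ^ 3 - 1)]

theorem hypersurfaceQ_eq_preimage : hypersurfaceQ = powSubOne ⁻¹' quadricCone := rfl

theorem regularImage_eq_preimage : regularImage = powSubOne ⁻¹' regularCone :=
  Set.ext fun _ => and_congr Iff.rfl <| and_congr sub_ne_zero.symm <|
    and_congr sub_ne_zero.symm sub_left_inj.not.symm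

theorem isOpenMap_pow_sub_one (n : ℕ) [NeZero n] : IsOpenMap fun x : ℂ => x ^ n - 1 :=
  (isOpenMap_sub_right 1).comp (Complex.isOpenQuotientMap_pow n).isOpenMap

theorem isOpenMap_powSubOne : IsOpenMap powSubOne := by
  refine IsOpenMap.piMap (fun i => ?_) (by simp)
  fin_cases i
  exacts [isOpenMap_pow_sub_one 2, isOpenMap_pow_sub_one 2, isOpenMap_pow_sub_one 3,
    isOpenMap_pow_sub_one 3]

theorem quadricCone_subset_closure : quadricCone ⊆ closure regularCone := by
  intro a ha
  obtain ⟨l, m, v, w, h2, h0, h3, h1⟩ := exists_eq_mul_of_mul_eq_mul ha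
  let path (ε : ℂ) : Fin 4 → ℂ :=
    ![(l + ε) * (w + 2 * ε), m * (w + 2 * ε), (l + ε) * (v + ε), m * (v + ε)]
  have path_zero : path 0 = a := by
    ext i
    fin_cases i <;> simp [path, h0, h1, h2, h3]
  have path_continuous : Continuous path :=
    continuous_pi fun i => by fin_cases i <;> simp only [path] <;> fun_prop
  have path_tendsto : Tendsto path (𝓝[≠] 0) (𝓝 a) :=
    path_zero ▸ path_continuous.continuousWithinAt.tendsto
  refine mem_closure_of_tendsto path_tendsto ?_
  filter_upwards [eventually_add_mul_ne_zero l one_ne_zero,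
    eventually_add_mul_ne_zero v one_ne_zero, eventually_add_mul_ne_zero w two_ne_zero,
    eventually_add_mul_ne_zero (v - w) (neg_ne_zero.mpr one_ne_zero)] with ε hl hv hw hvw
  rw [one_mul] at hl hv
  refine ⟨?_, mul_ne_zero hl hw, mul_ne_zero hl hv, fun h => hvw ?_⟩
  · simp only [quadricCone, path, Set.mem_ofPred_eq, Matrix.cons_val]
    ring
  · linear_combination mul_left_cancel₀ hl h

theorem hypersurfaceQ_subset_closure : hypersurfaceQ ⊆ closure regularImage := by
  rw [hypersurfaceQ_eq_preimage, regularImage_eq_preimage]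
  exact (Set.preimage_mono quadricCone_subset_closure).trans
    isOpenMap_powSubOne.preimage_closure_subset_closure_preimage

theorem isZariskiDenseOpen_regularImage : IsZariskiDenseOpen hypersurfaceQ regularImage := by
  constructor
  · refine ⟨{(MvPolynomial.X 0 ^ 2 - 1) * (MvPolynomial.X 2 ^ 3 - 1)
      * (MvPolynomial.X 2 ^ 3 - MvPolynomial.X 0 ^ 2)}, ?_⟩
    ext q
    simp [regularImage, sub_eq_zero, not_or, and_assoc]
  · intro P hP q hq
    have isClosed_zeros : IsClosed {q | MvPolynomial.eval q P = 0} :=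
      isClosed_eq (MvPolynomial.continuous_eval P) continuous_const
    exact isClosed_zeros.closure_subset_iff.mpr hP (hypersurfaceQ_subset_closure hq)

theorem countable_setOf_px_eq_py_eq (P : ℂ × ℂ) :
    {c : ℂ | c ∉ lattice ∧ px c = P.1 ∧ py c = P.2}.Countable := by
  obtain h | ⟨a, ha⟩ := {c : ℂ | c ∉ lattice ∧ px c = P.1 ∧ py c = P.2}.eq_empty_or_nonempty
  · rw [h]
    exact Set.countable_empty
  · refine (countable_lattice.preimage (sub_left_injective (b := a))).mono ?_
    rintro c ⟨hc, hx, hy⟩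
    exact sub_mem_lattice_of_px_eq_of_py_eq ha.1 hc (ha.2.1.trans hx.symm) (ha.2.2.trans hy.symm)

theorem finite_setOf_pow_eq {R : Type*} [CommRing R] [IsDomain R] {n : ℕ} (hn : n ≠ 0) (k : R) :
    {a : R | a ^ n = k}.Finite := by
  classical
  exact (Polynomial.nthRoots n k).toFinset.finite_toSet.subset fun a ha => by
    simpa [Polynomial.mem_nthRoots (Nat.pos_of_ne_zero hn)] using ha

theorem countable_setOf_mem_or_py_sq_eq (k : ℂ) :
    {c : ℂ | c ∈ lattice ∨ py c ^ 2 = k}.Countable := by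
  have countable_points : ({a : ℂ | a ^ 3 = k - 1} ×ˢ {b : ℂ | b ^ 2 = k}).Countable :=
    ((finite_setOf_pow_eq three_ne_zero _).prod (finite_setOf_pow_eq two_ne_zero _)).countable
  refine (countable_lattice.union
    (countable_points.biUnion fun P _ => countable_setOf_px_eq_py_eq P)).mono fun c hc => ?_
  by_cases hmem : c ∈ lattice
  · exact Or.inl hmem
  · have hy : py c ^ 2 = k := hc.resolve_left hmem
    have hx : px c ^ 3 = k - 1 := by rw [← hy, py_sq hmem, add_sub_cancel_right]
    exact Or.inr (Set.mem_biUnion (x := (px c, py c)) ⟨hx, hy⟩ ⟨hmem, rfl, rfl⟩)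

theorem dense_regularLocus : Dense regularLocus := by
  intro z
  rw [mem_closure_iff_nhds]
  intro N hN
  rw [nhds_pi, mem_pi] at hN
  obtain ⟨I, -, t, ht, htN⟩ := hN
  have exists_mem_of_countable {s : Set ℂ} (hs : s.Countable) (i : Fin 3) :
      ∃ c ∈ t i, c ∉ s := mem_closure_iff_nhds.mp (hs.dense_compl ℂ (z i)) (t i) (ht i)
  obtain ⟨c, hct, hc⟩ := exists_mem_of_countable
    ((countable_setOf_mem_or_py_sq_eq 0).union (countable_setOf_mem_or_py_sq_eq 1)) 2
  obtain ⟨a, hat, ha⟩ := exists_mem_of_countable (countable_setOf_mem_or_py_sq_eq (py c ^ 2)) 0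
  obtain ⟨b, hbt, hb⟩ := exists_mem_of_countable countable_lattice 1
  simp only [Set.mem_union, Set.mem_ofPred_eq, not_or] at hc ha
  obtain ⟨⟨c_notMem, y_sq_ne_zero⟩, -, y_sq_ne_one⟩ := hc
  refine ⟨![a, b, c], htN fun i _ => ?_, fun i => ?_, fun hx => ?_, fun hy => ?_, ha.2⟩
  · fin_cases i
    exacts [hat, hbt, hct]
  · fin_cases i
    exacts [ha.1, hb, c_notMem]
  · exact y_sq_ne_one (by simpa [show px c = 0 from hx] using py_sq c_notMem)
  · exact y_sq_ne_zero (by simpa using hy)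

/-! ### The blow-up and its quotient `Y` -/

open Classical in
/-- The point of `ℙ²` that is the line through the origin and `v`; for `v = 0` it is an arbitrary
line. -/
def lineThrough (v : C3) : ℙ ℂ C3 :=
  if h : v = 0 then Classical.arbitrary _ else Projectivization.mk ℂ v h

theorem lineThrough_of_ne_zero {v : C3} (hv : v ≠ 0) :
    lineThrough v = Projectivization.mk ℂ v hv := dif_neg hv

theorem lineThrough_rep (ℓ : ℙ ℂ C3) : lineThrough ℓ.rep = ℓ := by
  rw [lineThrough_of_ne_zero ℓ.rep_nonzero, ℓ.mk_rep]

theorem mem_lineThrough (v : C3) : v ∈ (lineThrough v).submodule := by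
  rcases eq_or_ne v 0 with rfl | hv
  · exact Submodule.zero_mem _
  · rw [lineThrough_of_ne_zero hv, Projectivization.submodule_mk]
    exact Submodule.mem_span_singleton_self v

theorem eq_lineThrough_of_mem {ℓ : ℙ ℂ C3} {v : C3} (hv : v ≠ 0) (h : v ∈ ℓ.submodule) :
    ℓ = lineThrough v := by
  rw [Projectivization.submodule_eq, Submodule.mem_span_singleton] at h
  rw [lineThrough_of_ne_zero hv, ← ℓ.mk_rep, eq_comm, Projectivization.mk_eq_mk_iff']
  exact h

theorem lineThrough_smul {a : ℂ} (ha : a ≠ 0) (v : C3) : lineThrough (a • v) = lineThrough v := by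
  rcases eq_or_ne v 0 with rfl | hv
  · rw [smul_zero]
  · refine (eq_lineThrough_of_mem (smul_ne_zero ha hv) ?_).symm
    exact Submodule.smul_mem _ a (mem_lineThrough v)

theorem continuousAt_lineThrough {v : C3} (hv : v ≠ 0) : ContinuousAt lineThrough v := by
  have restrict : lineThrough ∘ (Subtype.val : {v : C3 // v ≠ 0} → C3) = Projectivization.mk' ℂ :=
    funext fun v => lineThrough_of_ne_zero v.2
  have continuous_restrict : Continuous (lineThrough ∘ (Subtype.val : {v : C3 // v ≠ 0} → C3)) :=
    restrict ▸ continuous_quotient_mk'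
  exact ((isOpen_ne (x := (0 : C3))).isOpenEmbedding_subtypeVal.continuousAt_iff
    (x := ⟨v, hv⟩)).mp continuous_restrict.continuousAt

theorem frequently_add_smul_mem {𝕜 E : Type*} [NontriviallyNormedField 𝕜]
    [NormedAddCommGroup E] [NormedSpace 𝕜 E] {S : Set E} (hS : Dense S) (z v : E) :
    ∃ᶠ t : 𝕜 × E in 𝓝[{t | t.1 ≠ 0}] (0, v), z + t.1 • t.2 ∈ S := by
  rw [frequently_nhdsWithin_iff, frequently_iff]
  intro N hN
  rw [nhds_prod_eq, mem_prod_iff] at hN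
  obtain ⟨A, hA, B, hB, hAB⟩ := hN
  obtain ⟨ε, hεA, hε⟩ : (A ∩ {0}ᶜ).Nonempty :=
    nonempty_of_mem (inter_mem (nhdsWithin_le_nhds hA) self_mem_nhdsWithin)
  have dense_preimage : Dense ((fun v : E => z + ε • v) ⁻¹' S) :=
    hS.preimage ((Homeomorph.smulOfNeZero ε hε).trans (Homeomorph.addLeft z)).isOpenMap
  obtain ⟨u, huB, hu⟩ := mem_closure_iff_nhds.mp (dense_preimage v) B hB
  exact ⟨(ε, u), hAB ⟨hεA, huB⟩, hu, hε⟩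

namespace BlowUp

theorem continuous_z : Continuous BlowUp.z :=
  continuous_fst.comp (continuous_induced_dom (f := fun x : BlowUp => (x.z, x.line)))

/-- A point of the blow-up over `z`; it is unique unless `z` is blown up. -/
def ofBase (z : C3) : BlowUp where
  z := z
  line p := lineThrough (z - p)
  incident p := mem_lineThrough (z - p)

theorem line_eq_lineThrough (x : BlowUp) {p : fixedPoints} (hp : x.z ≠ p) :
    x.line p = lineThrough (x.z - p) :=
  eq_lineThrough_of_mem (sub_ne_zero.mpr hp) (x.incident p)

theorem ne_of_notMem {z : C3} (hz : z ∉ fixedPoints) (p : fixedPoints) : z ≠ p :=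
  fun h => hz (h ▸ p.2)

theorem ofBase_z {x : BlowUp} (hx : x.z ∉ fixedPoints) : ofBase x.z = x :=
  BlowUp.ext rfl (funext fun p => (x.line_eq_lineThrough (ne_of_notMem hx p)).symm)

theorem tendsto_iff {ι : Type*} {l : Filter ι} {f : ι → BlowUp} {x : BlowUp} :
    Tendsto f l (𝓝 x) ↔ Tendsto (fun i => (f i).z) l (𝓝 x.z) ∧
      ∀ p, Tendsto (fun i => (f i).line p) l (𝓝 (x.line p)) := by
  rw [nhds_induced, tendsto_comap_iff, nhds_prod_eq, tendsto_prod_iff']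
  exact and_congr Iff.rfl tendsto_pi_nhds

theorem continuousAt_ofBase {z : C3} (hz : z ∉ fixedPoints) : ContinuousAt ofBase z :=
  tendsto_iff.mpr ⟨continuousAt_id, fun p =>
    (continuousAt_lineThrough (sub_ne_zero.mpr (ne_of_notMem hz p))).comp_of_eq
      (by fun_prop : ContinuousAt (fun w : C3 => w - (p : C3)) z) rfl⟩

theorem exists_direction (x : BlowUp) :
    ∃ v ≠ 0, ∀ p : fixedPoints, x.z = p → x.line p = lineThrough v := by
  by_cases hx : x.z ∈ fixedPoints
  · refine ⟨_, (x.line ⟨x.z, hx⟩).rep_nonzero, fun p hp => ?_⟩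
    rw [lineThrough_rep, show p = ⟨x.z, hx⟩ from Subtype.ext hp.symm]
  · exact ⟨1, one_ne_zero, fun p hp => absurd hp (ne_of_notMem hx p)⟩

/-- Every point of the exceptional divisor over `x.z` is approached along the line it stands for. -/
theorem tendsto_ofBase_add_smul {x : BlowUp} {v : C3} (hv : v ≠ 0)
    (hline : ∀ p : fixedPoints, x.z = p → x.line p = lineThrough v) :
    Tendsto (fun t : ℂ × C3 => ofBase (x.z + t.1 • t.2)) (𝓝[{t | t.1 ≠ 0}] (0, v))
      (𝓝 x) := by
  have tendsto_z : Tendsto (fun t : ℂ × C3 => x.z + t.1 • t.2) (𝓝 (0, v)) (𝓝 x.z) :=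
    Continuous.tendsto' (by fun_prop) _ _ (by simp)
  refine tendsto_iff.mpr ⟨tendsto_z.mono_left nhdsWithin_le_nhds, fun p => ?_⟩
  by_cases hp : x.z = p
  · rw [hline p hp]
    have tendsto_line : Tendsto (fun t : ℂ × C3 => lineThrough t.2)
        (𝓝[{t | t.1 ≠ 0}] (0, v)) (𝓝 (lineThrough v)) :=
      (continuousAt_lineThrough hv).tendsto.comp
        ((continuous_snd.tendsto (0, v)).mono_left nhdsWithin_le_nhds)
    refine tendsto_line.congr' ?_
    filter_upwards [self_mem_nhdsWithin] with t ht
    change lineThrough t.2 = lineThrough (x.z + t.1 • t.2 - p)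
    rw [← hp, add_sub_cancel_left, lineThrough_smul ht]
  · rw [x.line_eq_lineThrough hp]
    exact (continuousAt_lineThrough (sub_ne_zero.mpr hp)).tendsto.comp
      ((tendsto_z.sub_const _).mono_left nhdsWithin_le_nhds)

theorem dense_preimage_z {S : Set C3} (hS : Dense S) : Dense (BlowUp.z ⁻¹' S) := by
  intro x
  obtain ⟨v, hv, hline⟩ := x.exists_direction
  exact mem_closure_of_frequently_of_tendsto (frequently_add_smul_mem hS x.z v)
    (tendsto_ofBase_add_smul hv hline)

theorem holAt_of_analyticAt {f : BlowUp → ℂ} {F : C3 → ℂ} {x : BlowUp}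
    (hF : AnalyticAt ℂ F x.z) (h : ∀ᶠ y in 𝓝 x, f y = F y.z) : BlowUp.HolAt f x := by
  by_cases hx : x.z ∈ fixedPoints
  · obtain ⟨i, hi⟩ := Function.ne_iff.mp (x.line ⟨x.z, hx⟩).rep_nonzero
    exact Or.inr ⟨⟨x.z, hx⟩, rfl, i, hi, fun q => F q.1, hF.comp_of_eq analyticAt_fst rfl, h⟩
  · exact Or.inl ⟨hx, F, hF, h⟩

end BlowUp

/-- A function on `ℂ³` that is invariant under the affine maps that induce `diag(ζ, ζ, ζ)` on
`E_ω³`, with `ζ ∈ ⟨-ω⟩`. -/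
def IsInvariant {α : Sort*} (f : C3 → α) : Prop :=
  ∀ ζ ∈ G, ∀ z w : C3, toTorus w = toTorus ((ζ : ℂ) • z) → f w = f z

namespace Y

theorem isQuotientMap_mk : Topology.IsQuotientMap Y.mk := isQuotientMap_quot_mk

theorem continuous_mk : Continuous Y.mk := isQuotientMap_mk.continuous

theorem mk_surjective : Function.Surjective Y.mk := Quotient.mk_surjective

theorem mk_eq_of_notMem {x y : BlowUp} (hx : x.z ∉ fixedPoints) {ζ : ℂˣ} (hζ : ζ ∈ G)
    (h : toTorus y.z = toTorus ((ζ : ℂ) • x.z)) : Y.mk x = Y.mk y := by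
  refine Quotient.sound ⟨ζ, hζ, h, fun p p' hp => ?_⟩
  have hxp : x.z ≠ p := BlowUp.ne_of_notMem hx p
  have sub_eq : y.z - (p' : C3) = (ζ : ℂ) • (x.z - p) := by rw [hp]; module
  have hyp' : y.z ≠ p' := by
    rw [← sub_ne_zero, sub_eq]
    exact smul_ne_zero ζ.ne_zero (sub_ne_zero.mpr hxp)
  rw [x.line_eq_lineThrough hxp, y.line_eq_lineThrough hyp', sub_eq, lineThrough_smul ζ.ne_zero]

/-- The function on `Y` induced by an invariant function on `ℂ³`. -/
def lift {α : Sort*} (f : C3 → α) (hf : IsInvariant f) : Y → α :=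
  Quotient.lift (fun x : BlowUp => f x.z) fun _ _ ⟨ζ, hζ, hT, _⟩ => (hf ζ hζ _ _ hT).symm

theorem isOpen_setOf_lift {S : C3 → Prop} (hS : IsInvariant S) (hopen : IsOpen {z | S z}) :
    IsOpen {y | Y.lift S hS y} :=
  isQuotientMap_mk.isOpen_preimage.mp (hopen.preimage BlowUp.continuous_z)

theorem dense_setOf_lift {S : C3 → Prop} (hS : IsInvariant S) (hdense : Dense {z | S z}) :
    Dense {y | Y.lift S hS y} :=
  mk_surjective.denseRange.dense_of_mapsTo continuous_mk (BlowUp.dense_preimage_z hdense)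
    fun _ hx => hx

end Y

/-! ### The isomorphism of Zariski open subsets -/

theorem isInvariant_regularLocus : IsInvariant (· ∈ regularLocus) := fun _ hζ _ _ h =>
  propext (regularLocus_iff_of_toTorus_eq hζ h)

theorem isInvariant_ratioMap : IsInvariant ratioMap := fun _ hζ _ _ h => ratioMap_of_toTorus_eq hζ h

/-- The open subset of `Y` over the regular locus. -/
def regularY : Set Y := {y | Y.lift (· ∈ regularLocus) isInvariant_regularLocus y}

theorem isOpen_regularY : IsOpen regularY := Y.isOpen_setOf_lift _ isOpen_regularLocus

theorem dense_regularY : Dense regularY := Y.dense_setOf_lift _ dense_regularLocus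

/-- The map from `Y` to `𝔸⁴` induced by `ratioMap`. -/
def Y.ratio : Y → Fin 4 → ℂ := Y.lift ratioMap isInvariant_ratioMap

theorem continuousOn_ratio : ContinuousOn Y.ratio regularY := by
  rw [Y.isQuotientMap_mk.continuousOn_isOpen_iff isOpen_regularY]
  exact fun x hx => ((analyticAt_ratioMap hx).continuousAt.comp_of_eq
    BlowUp.continuous_z.continuousAt rfl).continuousWithinAt

theorem ratio_mem_regularImage {y : Y} (hy : y ∈ regularY) : Y.ratio y ∈ regularImage := by
  obtain ⟨x, rfl⟩ := Y.mk_surjective y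
  exact ratioMap_mem_regularImage hy

/-- The restriction of `Y.ratio` to `regularY`, with values in `regularImage`. -/
def ratioRestrict (y : regularY) : regularImage := ⟨Y.ratio y, ratio_mem_regularImage y.2⟩

theorem continuous_ratioRestrict : Continuous ratioRestrict :=
  Continuous.subtype_mk continuousOn_ratio.domRestrict _

theorem injective_ratioRestrict : Function.Injective ratioRestrict := by
  rintro ⟨a, ha⟩ ⟨b, hb⟩ h
  obtain ⟨x, rfl⟩ := Y.mk_surjective a
  obtain ⟨y, rfl⟩ := Y.mk_surjective b
  obtain ⟨ζ, hζ, hT⟩ := exists_smul_of_ratioMap_eq ha hb (Subtype.ext_iff.mp h).symm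
  exact Subtype.ext (Y.mk_eq_of_notMem (notMem_fixedPoints_of_mem_regularLocus ha) hζ hT)

theorem surjective_ratioRestrict : Function.Surjective ratioRestrict := by
  rintro ⟨q, hq⟩
  obtain ⟨z, hz, rfl⟩ := exists_ratioMap_eq hq
  exact ⟨⟨Y.mk (BlowUp.ofBase z), hz⟩, rfl⟩

/-- The bijection of `regularY` with `regularImage` given by `ratioRestrict`. -/
def ratioEquiv : regularY ≃ regularImage :=
  Equiv.ofBijective ratioRestrict ⟨injective_ratioRestrict, surjective_ratioRestrict⟩

theorem exists_analyticAt_ratioEquiv_symm_eq {x : BlowUp} (hx : x.z ∈ regularLocus) :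
    ∃ Ψ : (Fin 4 → ℂ) → C3, AnalyticAt ℂ Ψ (ratioMap x.z) ∧ Ψ (ratioMap x.z) = x.z ∧
      ∀ᶠ q in 𝓝 (ratioEquiv ⟨Y.mk x, hx⟩),
        (ratioEquiv.symm q : Y) = Y.mk (BlowUp.ofBase (Ψ q)) := by
  obtain ⟨Ψ, hΨ, hΨx, hsection⟩ := exists_local_section hx
  refine ⟨Ψ, hΨ, hΨx, ?_⟩
  have tendsto_val : Tendsto (Subtype.val : regularImage → Fin 4 → ℂ)
      (𝓝 (ratioEquiv ⟨Y.mk x, hx⟩)) (𝓝 (ratioMap x.z)) := continuous_subtype_val.tendsto _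
  have eventually_mem : ∀ᶠ q in 𝓝 (ratioMap x.z), Ψ q ∈ regularLocus :=
    hΨ.continuousAt.eventually_mem (isOpen_regularLocus.mem_nhds (hΨx.symm ▸ hx))
  filter_upwards [tendsto_val.eventually hsection, tendsto_val.eventually eventually_mem]
    with q hq hmem
  have symm_eq : ratioEquiv.symm q = ⟨Y.mk (BlowUp.ofBase (Ψ q)), hmem⟩ :=
    ratioEquiv.symm_apply_eq.mpr (Subtype.ext (hq q.2).symm)
  exact congrArg Subtype.val symm_eq

theorem tendsto_ofBase_comp {x : BlowUp} (hx : x.z ∈ regularLocus) {Ψ : (Fin 4 → ℂ) → C3}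
    (hΨ : AnalyticAt ℂ Ψ (ratioMap x.z)) (hΨx : Ψ (ratioMap x.z) = x.z) :
    Tendsto (fun q : regularImage => BlowUp.ofBase (Ψ q)) (𝓝 (ratioEquiv ⟨Y.mk x, hx⟩))
      (𝓝 x) := by
  have hfix := notMem_fixedPoints_of_mem_regularLocus hx
  have ofBase_tendsto : Tendsto (BlowUp.ofBase ∘ Ψ) (𝓝 (ratioMap x.z)) (𝓝 x) := by
    simpa only [ContinuousAt, Function.comp_apply, hΨx, BlowUp.ofBase_z hfix] using
      (BlowUp.continuousAt_ofBase hfix).comp_of_eq hΨ.continuousAt hΨx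
  exact ofBase_tendsto.comp (continuous_subtype_val.tendsto (ratioEquiv ⟨Y.mk x, hx⟩))

theorem continuous_ratioEquiv_symm : Continuous ratioEquiv.symm := by
  refine continuous_iff_continuousAt.mpr fun q => ?_
  obtain ⟨⟨y, hy⟩, rfl⟩ := ratioEquiv.surjective q
  obtain ⟨x, rfl⟩ := Y.mk_surjective y
  obtain ⟨Ψ, hΨ, hΨx, symm_eq⟩ := exists_analyticAt_ratioEquiv_symm_eq (x := x) hy
  rw [ContinuousAt, Equiv.symm_apply_apply, tendsto_subtype_rng]
  exact ((Y.continuous_mk.tendsto x).comp (tendsto_ofBase_comp hy hΨ hΨx)).congr'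
    (symm_eq.mono fun _ h => h.symm)

/-- The isomorphism of `regularY` with `regularImage`. -/
def ratioHomeomorph : regularY ≃ₜ regularImage where
  toEquiv := ratioEquiv
  continuous_toFun := continuous_ratioRestrict
  continuous_invFun := continuous_ratioEquiv_symm

theorem exists_analyticAt_of_holAt {u : regularY} {h : Y → ℂ} (hol : Y.HolAt h u) :
    ∃ F : (Fin 4 → ℂ) → ℂ, AnalyticAt ℂ F (ratioHomeomorph u : Fin 4 → ℂ) ∧
      ∀ᶠ u' : regularY in 𝓝 u, h (u' : Y) = F (ratioHomeomorph u' : Fin 4 → ℂ) := by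
  obtain ⟨y, hy⟩ := u
  obtain ⟨x, rfl⟩ := Y.mk_surjective y
  have hx : x.z ∈ regularLocus := hy
  obtain ⟨H, hH, hHx⟩ : ∃ H : C3 → ℂ, AnalyticAt ℂ H x.z ∧ ∀ᶠ y in 𝓝 x, h (Y.mk y) = H y.z := by
    rcases hol x rfl with ⟨-, away⟩ | ⟨p, hp, -⟩
    · exact away
    · exact absurd hp (BlowUp.ne_of_notMem (notMem_fixedPoints_of_mem_regularLocus hx) p)
  obtain ⟨Ψ, hΨ, hΨx, symm_eq⟩ := exists_analyticAt_ratioEquiv_symm_eq hx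
  refine ⟨H ∘ Ψ, hH.comp_of_eq hΨ hΨx, ?_⟩
  have ratio_tendsto : Tendsto ratioHomeomorph (𝓝 ⟨Y.mk x, hy⟩)
      (𝓝 (ratioEquiv ⟨Y.mk x, hx⟩)) := ratioHomeomorph.continuous.tendsto _
  filter_upwards [ratio_tendsto.eventually symm_eq,
    ratio_tendsto.eventually ((tendsto_ofBase_comp hx hΨ hΨx).eventually hHx)] with u hu hHu
  have mk_eq : (u : Y) = Y.mk (BlowUp.ofBase (Ψ (ratioHomeomorph u))) := by
    rw [← hu]
    exact congrArg Subtype.val (ratioEquiv.symm_apply_apply u).symm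
  rw [mk_eq, hHu]
  rfl

theorem holAt_of_exists_analyticAt {u : regularY} {h : Y → ℂ} {F : (Fin 4 → ℂ) → ℂ}
    (hF : AnalyticAt ℂ F (ratioHomeomorph u : Fin 4 → ℂ))
    (hu : ∀ᶠ u' : regularY in 𝓝 u, h (u' : Y) = F (ratioHomeomorph u' : Fin 4 → ℂ)) :
    Y.HolAt h u := by
  obtain ⟨y, hy⟩ := u
  rintro x rfl
  have hx : x.z ∈ regularLocus := hy
  refine BlowUp.holAt_of_analyticAt (F := F ∘ ratioMap)
    (hF.comp_of_eq (analyticAt_ratioMap hx) rfl) ?_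
  rw [nhds_subtype_eq_comap, eventually_comap] at hu
  have mk_tendsto := Y.continuous_mk.tendsto x
  filter_upwards [mk_tendsto.eventually hu,
    mk_tendsto.eventually_mem (isOpen_regularY.mem_nhds hy)] with x' hx' hmem
  exact hx' ⟨Y.mk x', hmem⟩ rfl

/-! ### Homogeneous coordinates near the poles -/

/-- Holomorphic homogeneous coordinates `[fst : snd]` of a function `p` of weight `k` on an open
subset of `ℂ` that may contain poles of `p`. The group `⟨-ω⟩` multiplies the two coordinates by
powers of the character `ζ ↦ ζ ^ k` which differ by one. -/
structure HomogeneousChart (k : ℕ) (p : ℂ → ℂ) where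
  /-- The open set on which the coordinates are holomorphic. -/
  domain : Set ℂ
  /-- The numerator of `p`. -/
  fst : ℂ → ℂ
  /-- The denominator of `p`. -/
  snd : ℂ → ℂ
  /-- The power of `ζ ^ k` by which `ζ` multiplies `snd`. -/
  weight : ℕ
  isOpen_domain : IsOpen domain
  analyticOnNhd_fst : AnalyticOnNhd ℂ fst domain
  analyticOnNhd_snd : AnalyticOnNhd ℂ snd domain
  snd_ne_zero_iff : ∀ z ∈ domain, snd z ≠ 0 ↔ z ∉ lattice
  fst_eq : ∀ z ∈ domain, z ∉ lattice → fst z = p z * snd z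
  mem_domain_iff : ∀ ζ ∈ G, ∀ z w : ℂ, (w : Eomega) = ((ζ * z : ℂ) : Eomega) →
    (w ∈ domain ↔ z ∈ domain)
  fst_smul : ∀ ζ ∈ G, ∀ z w : ℂ, (w : Eomega) = ((ζ * z : ℂ) : Eomega) →
    fst w = ((ζ : ℂ) ^ k) ^ (weight + 1) * fst z
  snd_smul : ∀ ζ ∈ G, ∀ z w : ℂ, (w : Eomega) = ((ζ * z : ℂ) : Eomega) →
    snd w = ((ζ : ℂ) ^ k) ^ weight * snd z

namespace IsWeightedElliptic

variable {k : ℕ} {p : ℂ → ℂ}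

/-- The homogeneous coordinates `[p : 1]` away from the poles of `p`. -/
def finiteChart (hp : IsWeightedElliptic k p) : HomogeneousChart k p where
  domain := (lattice : Set ℂ)ᶜ
  fst := p
  snd := 1
  weight := 0
  isOpen_domain := isOpen_compl_lattice
  analyticOnNhd_fst := hp.analyticAt
  analyticOnNhd_snd _ _ := analyticAt_const
  snd_ne_zero_iff _ hz := iff_of_true one_ne_zero hz
  fst_eq _ _ _ := (mul_one _).symm
  mem_domain_iff _ hζ _ _ h := (mem_lattice_iff_of_coe_eq hζ h).not
  fst_smul _ hζ _ _ h := by rw [zero_add, pow_one, hp.apply_eq_of_coe_eq hζ h]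
  snd_smul _ _ _ _ _ := by rw [pow_zero, one_mul]; rfl

theorem isOpen_setOf_mem_or_ne_zero (hp : IsWeightedElliptic k p) :
    IsOpen {z | z ∈ lattice ∨ p z ≠ 0} := by
  refine isOpen_iff_mem_nhds.mpr fun z hz => ?_
  by_cases hl : z ∈ lattice
  · filter_upwards [eventually_nhdsWithin_iff.mp (hp.eventually_ne_zero hl)] with w hw
    exact or_iff_not_imp_left.mpr fun notMem => hw fun h => notMem (h ▸ hl)
  · exact ((hp.analyticAt z hl).continuousAt.eventually_ne (hz.resolve_left hl)).mono
      fun _ => Or.inr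

/-- The homogeneous coordinates `[1 : p⁻¹]` away from the zeros of `p`. As `p` takes the junk value
`0` at its poles, `p⁻¹` takes there the correct value `0`. -/
def poleChart (hp : IsWeightedElliptic k p) : HomogeneousChart k p where
  domain := {z | z ∈ lattice ∨ p z ≠ 0}
  fst := 1
  snd := p⁻¹
  weight := 5
  isOpen_domain := hp.isOpen_setOf_mem_or_ne_zero
  analyticOnNhd_fst _ _ := analyticAt_const
  analyticOnNhd_snd z hz := by
    by_cases hl : z ∈ lattice
    · exact hp.analyticAt_inv hl
    · exact (hp.analyticAt z hl).inv (hz.resolve_left hl)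
  snd_ne_zero_iff z hz := inv_eq_zero.not.trans ⟨hp.notMem_of_ne_zero, hz.resolve_left⟩
  fst_eq _ hz hl := (mul_inv_cancel₀ (hz.resolve_left hl)).symm
  mem_domain_iff ζ hζ z w h := by
    refine or_congr (mem_lattice_iff_of_coe_eq hζ h) (not_congr ?_)
    rw [hp.apply_eq_of_coe_eq hζ h, mul_eq_zero_iff_left (pow_ne_zero k ζ.ne_zero)]
  fst_smul ζ hζ _ _ _ := by
    rw [pow_right_comm, mem_G_iff.mp hζ, one_pow, one_mul]
    rfl
  snd_smul ζ hζ z w h := by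
    have pow_six : ((ζ : ℂ) ^ k) ^ 5 * (ζ : ℂ) ^ k = 1 := by
      rw [← pow_succ, pow_right_comm, mem_G_iff.mp hζ, one_pow]
    rw [Pi.inv_apply, Pi.inv_apply, hp.apply_eq_of_coe_eq hζ h, mul_inv,
      ← eq_inv_of_mul_eq_one_left pow_six]

theorem exists_mem_domain (hp : IsWeightedElliptic k p) (z : ℂ) :
    ∃ C : HomogeneousChart k p, z ∈ C.domain := by
  by_cases hz : z ∈ lattice
  · exact ⟨hp.poleChart, Or.inl hz⟩
  · exact ⟨hp.finiteChart, hz⟩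

end IsWeightedElliptic

/-- The product of the domains of three charts. -/
def chartDomain {k : ℕ} {p : ℂ → ℂ} (C : Fin 3 → HomogeneousChart k p) : Set C3 :=
  {z | ∀ i, z i ∈ (C i).domain}

section ChartDomain

variable {k : ℕ} {p : ℂ → ℂ} (C : Fin 3 → HomogeneousChart k p) {z : C3}

theorem isInvariant_chartDomain : IsInvariant (· ∈ chartDomain C) := fun ζ hζ _ _ h =>
  propext (forall_congr' fun i => (C i).mem_domain_iff ζ hζ _ _ (congrFun h i))

theorem isOpen_chartDomain : IsOpen (chartDomain C) := by
  simp only [chartDomain, Set.ofPred_forall]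
  exact isOpen_iInter_of_finite fun i => (C i).isOpen_domain.preimage (continuous_apply i)

variable {C}

theorem analyticAt_fst_apply (hz : z ∈ chartDomain C) (i : Fin 3) :
    AnalyticAt ℂ (fun w : C3 => (C i).fst (w i)) z :=
  ((C i).analyticOnNhd_fst _ (hz i)).comp_of_eq (analyticAt_apply i z) rfl

theorem analyticAt_snd_apply (hz : z ∈ chartDomain C) (i : Fin 3) :
    AnalyticAt ℂ (fun w : C3 => (C i).snd (w i)) z :=
  ((C i).analyticOnNhd_snd _ (hz i)).comp_of_eq (analyticAt_apply i z) rfl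

variable (C) in
/-- The open subset of `Y` over `chartDomain C`. -/
def chartNhd : Set Y := {y | Y.lift (· ∈ chartDomain C) (isInvariant_chartDomain C) y}

variable (C) in
theorem isOpen_chartNhd : IsOpen (chartNhd C) := Y.isOpen_setOf_lift _ (isOpen_chartDomain C)

theorem holAt_lift {F : C3 → ℂ} (hF : IsInvariant F)
    (analytic : ∀ z ∈ chartDomain C, AnalyticAt ℂ F z) {y : Y} (hy : y ∈ chartNhd C) :
    Y.HolAt (Y.lift F hF) y := by
  rintro x rfl
  exact BlowUp.holAt_of_analyticAt (analytic x.z hy) (Eventually.of_forall fun _ => rfl)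

end ChartDomain

/-! ### The complement of the regular locus is analytic -/

section Complement

variable (C : Fin 3 → HomogeneousChart 3 py)

/-- The product of the conditions that define `regularLocus`, in the homogeneous coordinates
`[fᵢ : gᵢ]` of the `yᵢ` and with `x₂³` replaced by `y₂² - 1`. -/
def complementEquation (z : C3) : ℂ :=
  (∏ i, (C i).snd (z i) ^ 2) * (C 2).fst (z 2) ^ 2 *
    ((C 2).fst (z 2) ^ 2 - (C 2).snd (z 2) ^ 2) *
    ((C 0).fst (z 0) ^ 2 * (C 2).snd (z 2) ^ 2 - (C 2).fst (z 2) ^ 2 * (C 0).snd (z 0) ^ 2)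

theorem isInvariant_complementEquation : IsInvariant (complementEquation C) := by
  intro ζ hζ z w h
  have pow_two_eq_one (n : ℕ) : (((ζ : ℂ) ^ 3) ^ n) ^ 2 = 1 := by
    rw [← pow_mul, ← pow_mul, show 3 * (n * 2) = 6 * n by ring, pow_mul, mem_G_iff.mp hζ, one_pow]
  have fst_sq (i : Fin 3) : (C i).fst (w i) ^ 2 = (C i).fst (z i) ^ 2 := by
    rw [(C i).fst_smul ζ hζ _ _ (congrFun h i), mul_pow, pow_two_eq_one, one_mul]
  have snd_sq (i : Fin 3) : (C i).snd (w i) ^ 2 = (C i).snd (z i) ^ 2 := by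
    rw [(C i).snd_smul ζ hζ _ _ (congrFun h i), mul_pow, pow_two_eq_one, one_mul]
  simp only [complementEquation, fst_sq, snd_sq]

variable {C} {z : C3}

theorem analyticAt_complementEquation (hz : z ∈ chartDomain C) :
    AnalyticAt ℂ (complementEquation C) z := by
  have fst_sq := fun i => (analyticAt_fst_apply hz i).pow 2
  have snd_sq := fun i => (analyticAt_snd_apply hz i).pow 2
  exact (((Finset.univ.analyticAt_fun_prod fun i _ => snd_sq i).mul (fst_sq 2)).mul
    ((fst_sq 2).sub (snd_sq 2))).mul
      (((fst_sq 0).mul (snd_sq 2)).sub ((fst_sq 2).mul (snd_sq 0)))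

theorem complementEquation_eq (hz : z ∈ chartDomain C) (notMem : ∀ i, z i ∉ lattice) :
    complementEquation C z =
      (∏ i, (C i).snd (z i) ^ 2) * ((C 0).snd (z 0) * (C 2).snd (z 2) ^ 3) ^ 2 *
        (px (z 2) ^ 3 * py (z 2) ^ 2 * (py (z 0) ^ 2 - py (z 2) ^ 2)) := by
  have fst_eq := fun i => (C i).fst_eq _ (hz i) (notMem i)
  rw [complementEquation, fst_eq 0, fst_eq 2, eq_sub_of_add_eq (py_sq (notMem 2)).symm]
  ring

theorem complementEquation_ne_zero_iff (hz : z ∈ chartDomain C) :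
    complementEquation C z ≠ 0 ↔ z ∈ regularLocus := by
  have snd_ne_zero_iff := fun i => (C i).snd_ne_zero_iff _ (hz i)
  by_cases notMem : ∀ i, z i ∉ lattice
  · have snd_ne_zero := fun i => (snd_ne_zero_iff i).mpr (notMem i)
    simp [complementEquation_eq hz notMem, regularLocus, notMem, snd_ne_zero, sub_eq_zero,
      Finset.prod_eq_zero_iff, and_assoc]
  · refine iff_of_false (not_not.mpr ?_) fun hr => notMem hr.1
    obtain ⟨i, hi⟩ := not_forall.mp notMem
    have snd_eq_zero : (C i).snd (z i) = 0 := not_ne_iff.mp ((snd_ne_zero_iff i).not.mpr hi)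
    rw [complementEquation, Finset.prod_eq_zero (Finset.mem_univ i) (by simp [snd_eq_zero])]
    ring

end Complement

theorem isAnalyticSubset_compl_regularY : Y.IsAnalyticSubset regularYᶜ := by
  intro y
  obtain ⟨x, rfl⟩ := Y.mk_surjective y
  choose C hC using fun i => isWeightedElliptic_py.exists_mem_domain (x.z i)
  refine ⟨chartNhd C, isOpen_chartNhd C, hC, 1,
    fun _ => Y.lift _ (isInvariant_complementEquation C),
    fun _ _ => holAt_lift _ fun _ => analyticAt_complementEquation, ?_⟩
  intro y' hy'
  obtain ⟨x', rfl⟩ := Y.mk_surjective y'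
  rw [forall_const]
  exact not_iff_comm.mp (complementEquation_ne_zero_iff hy')

/-! ### The coordinates are meromorphic -/

section Meromorphic

variable {k : ℕ} {p : ℂ → ℂ} (C : Fin 3 → HomogeneousChart k p) (m : ℕ) (i j : Fin 3)

/-- The numerator of `p (z i) / p (z j)` in homogeneous coordinates `[f : g]` of `p`, over the
denominator `chartDenominator`. The fraction `fᵢ gⱼ / (fⱼ gᵢ)` is expanded by `(fⱼ gᵢ) ^ m`, which
makes its numerator and denominator invariant when `ζ ^ k` is an `(m + 1)`-st root of unity. -/
def chartNumerator (z : C3) : ℂ :=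
  (C i).fst (z i) * (C j).snd (z j) * ((C j).fst (z j) * (C i).snd (z i)) ^ m

/-- The denominator that goes with `chartNumerator`. -/
def chartDenominator (z : C3) : ℂ :=
  ((C j).fst (z j) * (C i).snd (z i)) ^ (m + 1)

theorem exists_fst_mul_snd_eq {m : ℕ} (hm : 6 ∣ k * (m + 1)) {ζ : ℂˣ} (hζ : ζ ∈ G) {z w : C3}
    (h : toTorus w = toTorus ((ζ : ℂ) • z)) : ∃ c : ℂ, c ^ (m + 1) = 1 ∧
      (C i).fst (w i) * (C j).snd (w j) = c * ((C i).fst (z i) * (C j).snd (z j)) ∧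
      (C j).fst (w j) * (C i).snd (w i) = c * ((C j).fst (z j) * (C i).snd (z i)) := by
  have pow_eq_one : ((ζ : ℂ) ^ k) ^ (m + 1) = 1 := by
    obtain ⟨n, hn⟩ := hm
    rw [← pow_mul, hn, pow_mul, mem_G_iff.mp hζ, one_pow]
  have fst_smul := fun i => (C i).fst_smul ζ hζ _ _ (congrFun h i)
  have snd_smul := fun i => (C i).snd_smul ζ hζ _ _ (congrFun h i)
  refine ⟨((ζ : ℂ) ^ k) ^ ((C i).weight + (C j).weight + 1), ?_, ?_, ?_⟩
  · rw [pow_right_comm, pow_eq_one, one_pow]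
  all_goals rw [fst_smul, snd_smul]; ring

theorem isInvariant_chartNumerator {m : ℕ} (hm : 6 ∣ k * (m + 1)) :
    IsInvariant (chartNumerator C m i j) := by
  intro ζ hζ z w h
  obtain ⟨c, hc, hij, hji⟩ := exists_fst_mul_snd_eq C i j hm hζ h
  rw [chartNumerator, hij, hji, mul_pow, mul_mul_mul_comm, ← pow_succ', hc, one_mul, chartNumerator]

theorem isInvariant_chartDenominator {m : ℕ} (hm : 6 ∣ k * (m + 1)) :
    IsInvariant (chartDenominator C m i j) := by
  intro ζ hζ z w h
  obtain ⟨c, hc, -, hji⟩ := exists_fst_mul_snd_eq C i j hm hζ h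
  rw [chartDenominator, hji, mul_pow, hc, one_mul, chartDenominator]

variable {C} {z : C3}

theorem analyticAt_chartNumerator (hz : z ∈ chartDomain C) :
    AnalyticAt ℂ (chartNumerator C m i j) z :=
  ((analyticAt_fst_apply hz i).mul (analyticAt_snd_apply hz j)).mul
    (((analyticAt_fst_apply hz j).mul (analyticAt_snd_apply hz i)).pow m)

theorem analyticAt_chartDenominator (hz : z ∈ chartDomain C) :
    AnalyticAt ℂ (chartDenominator C m i j) z :=
  ((analyticAt_fst_apply hz j).mul (analyticAt_snd_apply hz i)).pow (m + 1)

variable {i j}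

theorem chartDenominator_ne_zero (hz : z ∈ chartDomain C) (hi : z i ∉ lattice) (hj : z j ∉ lattice)
    (hpj : p (z j) ≠ 0) : chartDenominator C m i j z ≠ 0 := by
  have snd_ne_zero := ((C j).snd_ne_zero_iff _ (hz j)).mpr hj
  rw [chartDenominator, (C j).fst_eq _ (hz j) hj]
  exact pow_ne_zero _ (mul_ne_zero (mul_ne_zero hpj snd_ne_zero)
    (((C i).snd_ne_zero_iff _ (hz i)).mpr hi))

theorem chartDenominator_mul_div (hz : z ∈ chartDomain C) (hi : z i ∉ lattice) (hj : z j ∉ lattice)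
    (hpj : p (z j) ≠ 0) :
    chartDenominator C m i j z * (p (z i) / p (z j)) = chartNumerator C m i j z := by
  have cross : (C j).fst (z j) * (C i).snd (z i) * (p (z i) / p (z j))
      = (C i).fst (z i) * (C j).snd (z j) := by
    rw [(C i).fst_eq _ (hz i) hi, (C j).fst_eq _ (hz j) hj]
    field_simp
  rw [chartDenominator, chartNumerator, pow_succ', mul_right_comm, cross]

end Meromorphic

theorem IsWeightedElliptic.isMeromorphic_of_eq_div {k m : ℕ} {p : ℂ → ℂ}
    (hp : IsWeightedElliptic k p) (hm : 6 ∣ k * (m + 1)) {i j : Fin 3}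
    (hpj : ∀ z ∈ regularLocus, p (z j) ≠ 0) {φ : regularY → ℂ}
    (hφ : ∀ (x : BlowUp) (hx : x.z ∈ regularLocus), φ ⟨Y.mk x, hx⟩ = p (x.z i) / p (x.z j)) :
    Y.IsMeromorphic regularY φ := by
  intro y
  obtain ⟨x, rfl⟩ := Y.mk_surjective y
  choose C hC using fun i => hp.exists_mem_domain (x.z i)
  refine ⟨chartNhd C, isOpen_chartNhd C, hC, Y.lift _ (isInvariant_chartNumerator C i j hm),
    Y.lift _ (isInvariant_chartDenominator C i j hm), fun _ hy =>
      ⟨holAt_lift _ (fun _ => analyticAt_chartNumerator m i j) hy,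
        holAt_lift _ (fun _ => analyticAt_chartDenominator m i j) hy⟩, ?_, ?_⟩
  · refine (dense_regularY.open_subset_closure_inter (isOpen_chartNhd C)).trans (closure_mono ?_)
    rintro y' ⟨hC', hy'⟩
    obtain ⟨x', rfl⟩ := Y.mk_surjective y'
    exact ⟨hC', chartDenominator_ne_zero m hC' (hy'.1 i) (hy'.1 j) (hpj _ hy')⟩
  · rintro ⟨y', hy'⟩ hC'
    obtain ⟨x', rfl⟩ := Y.mk_surjective y'
    rw [hφ x' hy']
    exact chartDenominator_mul_div m hC' (hy'.1 i) (hy'.1 j) (hpj _ hy')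

theorem isMeromorphic_ratioHomeomorph (n : Fin 4) :
    Y.IsMeromorphic regularY fun u => (ratioHomeomorph u : Fin 4 → ℂ) n := by
  have py_ratio (i : Fin 3) {φ : regularY → ℂ}
      (hφ : ∀ (x : BlowUp) (hx : x.z ∈ regularLocus), φ ⟨Y.mk x, hx⟩ = py (x.z i) / py (x.z 2)) :
      Y.IsMeromorphic regularY φ :=
    isWeightedElliptic_py.isMeromorphic_of_eq_div (m := 1) (by norm_num) (fun _ hz => hz.2.2.1) hφ
  have px_ratio (i : Fin 3) {φ : regularY → ℂ}
      (hφ : ∀ (x : BlowUp) (hx : x.z ∈ regularLocus), φ ⟨Y.mk x, hx⟩ = px (x.z i) / px (x.z 2)) :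
      Y.IsMeromorphic regularY φ :=
    isWeightedElliptic_px.isMeromorphic_of_eq_div (m := 2) (by norm_num) (fun _ hz => hz.2.1) hφ
  fin_cases n
  · exact py_ratio 0 fun _ _ => rfl
  · exact py_ratio 1 fun _ _ => rfl
  · exact px_ratio 0 fun _ _ => rfl
  · exact px_ratio 1 fun _ _ => rfl

end TorusQuotient

end

theorem theorem2p5 : TorusQuotient.Y.BirationalTo TorusQuotient.hypersurfaceQ := by
  open TorusQuotient in
  exact ⟨regularY, regularImage, ratioHomeomorph, isAnalyticSubset_compl_regularY,
    dense_regularY, isZariskiDenseOpen_regularImage,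
    fun _ _ => ⟨exists_analyticAt_of_holAt, fun ⟨_, hF, hu⟩ => holAt_of_exists_analyticAt hF hu⟩,
    isMeromorphic_ratioHomeomorph⟩
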